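/- For integers $m\ge 2$ and $k\ge 3$ let $$\Gamma_{m,k}=\min_{0<\gamma<1}\frac{1+\gamma+\dots+\gamma^{m-1}}{\gamma^{(m-1)/k}}.$$ Let $m\ge 2$ and $k\ge 3$ be fixed integers. Then there are constants $C$ and $N$, depending only on $m$ and $k$, such that for every integer $n\ge N$ divisible by $k$ there exist a positive integer $L\ge (\Gamma_{m,k})^{\,n-C\sqrt n}$ and a collection of $k$-tuples $(x_{1,j},x_{2,j},\dots,x_{k,j})_{j=1}^{L}$ of elements of $\mathbb Z^n$ such that - for all $j_1,\dots,j_k\in\{1,\dots,L\}$, $x_{1,j_1}+x_{2,j_2}+\dots+x_{k,j_k}=(m-1)\cdot\mathbb 1^n$ if and only if $j_1=j_2=\dots=j_k$, where $\mathbb 1^n=(1,\dots,1)\in\mathbb Z^n$; - all coordinates of all the vectors $x_{i,j}$ lie in $\{0,1,\dots,m-1\}$; - for each $x_{i,j}$, the sum of its $n$ coordinates equals $(m-1)n/k$. -/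

import Mathlib

/-- The constant `Γ_{m,k}`: the minimum over `0 < γ < 1` of
`(1 + γ + ⋯ + γ^(m-1)) / γ^((m-1)/k)`, written as an infimum of a nonempty set of positive reals
(for `m ≥ 2` and `k ≥ 3` it is attained). -/
noncomputable def Gam (m k : ℕ) : ℝ :=
  sInf ((fun γ : ℝ => (∑ i ∈ Finset.range m, γ ^ i) / γ ^ (((m : ℝ) - 1) / (k : ℝ))) ''
    Set.Ioo (0 : ℝ) 1)

/-!
Write `M = m - 1`. A collection as required is a set of `n`-column arrays with `k` rows, every column
being a `k`-tuple of elements of `{0, …, M}` with sum `M` (the type `Col k M`), such that any array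
recombined from rows of members, with all columns of sum `M`, is a member itself.

The value `Γ` is at most `exp h`, where `h` is the entropy of the geometric distribution
`ψ(v) ∝ γ ^ v` on `{0, …, M}` of mean `M / k`. The first ingredient is a distribution `π` on `Col k M`
of product form `π(a) = ∏ f(a_i)` all of whose marginals are `ψ` (`exists_product_weights`). It is
obtained by minimising a convex functional, which is coercive by a duality statement about
decreasing distributions (`decreasing_mean_le`). That statement reduces to finding a single `k`-tuple
of given sum on which a function is nonnegative (`hasGoodTuple_of_suffixNonneg`), and this is an
averaging argument over random lattice paths.

Round `n π` to a symmetric type `σ` (`exists_symmetric_type`) and let `O` be the arrays of column type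
`σ`; there are `exp (n H - O(log n))` of them, `H` being the entropy of `π`. As `π` has product form,
all arrays recombined from rows of members of `O` have the same probability under `π ^ n`, which
bounds their number (`card_equiv_words_le`).

Hash the rows of an array affinely to `ZMod p`, so that the hashes of the rows of any array add up to
zero, and let an array survive if its vector of hashes belongs to a large family of vectors whose
entries recombine to sum zero only trivially; Behrend's construction gives such a family of size
`p * exp (-O(√n))` (`exists_diagonal_family`). Two arrays sharing a row survive together with relative
probability `p ^ (-r)`, where `r` is the dimension of the span `U` of the column differences. The
number of arrays that differ from a given one by columns in `U` is about `exp (n r δ)` with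
`δ = (H - h) / (k - 2)` (`entropy_deficit_le`): entropy modulo `U`, plus `δ dim U`, is a submodular
function of `U`, so its least minimizer is invariant under permutations of the coordinates, and by
irreducibility it is one of the two extreme subspaces, where the values agree. For `p` a large
constant times `exp (n δ)`, up to a factor `exp (O(√n))`, most surviving arrays are therefore in
conflict with no other (`exists_isolated_words`). The isolated ones form the collection, of size about
`#O / p ^ (k - 2) = exp (n h - O(√n))`.
-/

open Finset

/-! ### Sums of tuples and lattice paths -/

/-- A sum over a uniformly random monotone lattice path from `(0, 0)` to `(p, q)`. On such a path
each value of `x`, of `y` and of `x + y` is visited equally often in expectation, so a function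
`F x + G y + H (x + y)` that is nonnegative on the grid gives a relation between the averages of
`F`, `G` and `H`. The induction conditions on the first step. -/
theorem lattice_path_sum_nonneg : ∀ (r p q : ℕ), p + q = r → ∀ (F G H : ℕ → ℝ),
    (∀ x ≤ p, ∀ y ≤ q, 0 ≤ F x + G y + H (x + y)) →
    0 ≤ ((p : ℝ) + q + 1) / (p + 1) * ∑ x ∈ range (p + 1), F x +
      ((p : ℝ) + q + 1) / (q + 1) * ∑ y ∈ range (q + 1), G y + ∑ c ∈ range (p + q + 1), H c := by
  intro r
  induction r with
  | zero =>
    intro p q hpq F G H h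
    obtain ⟨rfl, rfl⟩ : p = 0 ∧ q = 0 := by omega
    simpa using h 0 le_rfl 0 le_rfl
  | succ r ih =>
    intro p q hpq F G H h
    have h00 := h 0 (Nat.zero_le _) 0 (Nat.zero_le _)
    rw [sum_range_succ' H]
    -- the contribution of a first step to the right, weighted by its probability
    have hright : 0 ≤ (p : ℝ) / (p + q) * (((p : ℝ) + q) / p * ∑ x ∈ range p, F (x + 1) +
        ((p : ℝ) + q) / (q + 1) * ∑ y ∈ range (q + 1), G y +
        ∑ c ∈ range (p + q), H (c + 1)) := by
      rcases Nat.eq_zero_or_pos p with rfl | hp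
      · simp
      · obtain ⟨p, rfl⟩ : ∃ p', p = p' + 1 := ⟨p - 1, by omega⟩
        have := ih p q (by omega) (fun x => F (x + 1)) G (fun c => H (c + 1)) (by
          intro x hx y hy
          have := h (x + 1) (by omega) y hy
          rwa [show x + 1 + y = x + y + 1 by ring] at this)
        refine mul_nonneg (by positivity) ?_
        push_cast at this ⊢
        rw [show p + 1 + q = p + q + 1 by ring, show (p : ℝ) + 1 + q = p + q + 1 by ring]
        exact this
    have hup : 0 ≤ (q : ℝ) / (p + q) * (((p : ℝ) + q) / (p + 1) * ∑ x ∈ range (p + 1), F x +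
        ((p : ℝ) + q) / q * ∑ y ∈ range q, G (y + 1) +
        ∑ c ∈ range (p + q), H (c + 1)) := by
      rcases Nat.eq_zero_or_pos q with rfl | hq
      · simp
      · obtain ⟨q, rfl⟩ : ∃ q', q = q' + 1 := ⟨q - 1, by omega⟩
        have := ih p q (by omega) F (fun x => G (x + 1)) (fun c => H (c + 1)) (by
          intro x hx y hy
          have := h x hx (y + 1) (by omega)
          rwa [← add_assoc] at this)
        refine mul_nonneg (by positivity) ?_
        push_cast at this ⊢
        rw [show p + (q + 1) = p + q + 1 by ring, show (p : ℝ) + (q + 1) = p + q + 1 by ring]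
        exact this
    have hr : (0 : ℝ) < p + q := by
      have : (p : ℝ) + q = r + 1 := by exact_mod_cast hpq
      rw [this]; positivity
    have eF : ∑ x ∈ range (p + 1), F x = ∑ x ∈ range p, F (x + 1) + F 0 := sum_range_succ' _ _
    have eG : ∑ x ∈ range (q + 1), G x = ∑ x ∈ range q, G (x + 1) + G 0 := sum_range_succ' _ _
    have e1 : (p : ℝ) / (p + q) * (((p : ℝ) + q) / p * ∑ x ∈ range p, F (x + 1)) =
        ∑ x ∈ range p, F (x + 1) := by
      rcases Nat.eq_zero_or_pos p with rfl | hp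
      · simp
      · field_simp
    have e2 : (q : ℝ) / (p + q) * (((p : ℝ) + q) / q * ∑ x ∈ range q, G (x + 1)) =
        ∑ x ∈ range q, G (x + 1) := by
      rcases Nat.eq_zero_or_pos q with rfl | hp
      · simp
      · field_simp
    have e3 : (p : ℝ) / (p + q) * (((p : ℝ) + q) / (q + 1) * ∑ y ∈ range (q + 1), G y) =
        (p : ℝ) / (q + 1) * ∑ y ∈ range (q + 1), G y := by field_simp
    have e4 : (q : ℝ) / (p + q) * (((p : ℝ) + q) / (p + 1) * ∑ y ∈ range (p + 1), F y) =
        (q : ℝ) / (p + 1) * ∑ y ∈ range (p + 1), F y := by field_simp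
    have e5 : (p : ℝ) / (p + q) * ∑ c ∈ range (p + q), H (c + 1) +
        (q : ℝ) / (p + q) * ∑ c ∈ range (p + q), H (c + 1) = ∑ c ∈ range (p + q), H (c + 1) := by
      rw [← add_mul, ← add_div, div_self hr.ne', one_mul]
    have e6 : ((p : ℝ) + q + 1) / (p + 1) = 1 + q / (p + 1) := by field_simp; ring
    have e7 : ((p : ℝ) + q + 1) / (q + 1) = 1 + p / (q + 1) := by field_simp; ring
    rw [mul_add, mul_add, e1, e3] at hright
    rw [mul_add, mul_add, e2, e4] at hup
    rw [e6, e7, add_mul, add_mul, one_mul, one_mul]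
    linarith

/-- The strict form of `lattice_path_sum_nonneg`: all paths start at `(0, 0)`, so the surplus there
can be taken off `H 0`. -/
theorem lattice_path_sum_pos {p q : ℕ} {F G H : ℕ → ℝ}
    (h : ∀ x ≤ p, ∀ y ≤ q, 0 < F x + G y + H (x + y)) :
    0 < ((p : ℝ) + q + 1) / (p + 1) * ∑ x ∈ range (p + 1), F x +
      ((p : ℝ) + q + 1) / (q + 1) * ∑ y ∈ range (q + 1), G y + ∑ c ∈ range (p + q + 1), H c := by
  have h0 := h 0 (Nat.zero_le _) 0 (Nat.zero_le _)
  have := lattice_path_sum_nonneg _ p q rfl F G (fun c => if c = 0 then - F 0 - G 0 else H c) (by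
    intro x hx y hy
    by_cases hxy : x + y = 0
    · obtain ⟨rfl, rfl⟩ : x = 0 ∧ y = 0 := by omega
      simp
    · rw [if_neg hxy]
      exact (h x hx y hy).le)
  rw [sum_range_succ' _ (p + q)] at this ⊢
  simp only [Nat.add_eq_zero_iff, one_ne_zero, and_false, if_false, if_true] at this
  simp only [add_zero] at h0
  linarith

/-- All sums of `θ` over intervals `[x, j]` are nonnegative. -/
def SuffixNonneg (θ : ℕ → ℝ) (j : ℕ) : Prop :=
  ∀ x y : ℕ, x + y = j → 0 ≤ ∑ i ∈ range (y + 1), θ (x + i)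

/-- Some `k` natural numbers with sum `s` have a nonnegative total under `θ`. -/
def HasGoodTuple (θ : ℕ → ℝ) (k s : ℕ) : Prop :=
  ∃ a : List ℕ, a.length = k ∧ a.sum = s ∧ 0 ≤ (a.map θ).sum

theorem SuffixNonneg.apply_nonneg {θ : ℕ → ℝ} {j : ℕ} (h : SuffixNonneg θ j) : 0 ≤ θ j := by
  simpa using h j 0 rfl

theorem HasGoodTuple.cons {θ : ℕ → ℝ} {k s v : ℕ} (h : HasGoodTuple θ k s) (hv : 0 ≤ θ v) :
    HasGoodTuple θ (k + 1) (v + s) := by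
  obtain ⟨a, h1, h2, h3⟩ := h
  exact ⟨v :: a, by simp [h1], by simp [h2], by simpa using add_nonneg hv h3⟩

theorem HasGoodTuple.append {θ : ℕ → ℝ} {k k' s s' : ℕ} (h : HasGoodTuple θ k s)
    (h' : HasGoodTuple θ k' s') : HasGoodTuple θ (k + k') (s + s') := by
  obtain ⟨a, h1, h2, h3⟩ := h
  obtain ⟨b, h1', h2', h3'⟩ := h'
  exact ⟨a ++ b, by simp [h1, h1'], by simp [h2, h2'], by simpa using add_nonneg h3 h3'⟩

/-- The pairs `(u, s - u)` run over an interval ending at `l` in both coordinates. -/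
theorem hasGoodTuple_two {θ : ℕ → ℝ} {l s : ℕ} (h : SuffixNonneg θ l) (h1 : l ≤ s)
    (h2 : s ≤ 2 * l) : HasGoodTuple θ 2 s := by
  by_contra hcon
  have hneg : ∀ u v, u + v = s → θ u + θ v < 0 := by
    intro u v huv
    by_contra hge
    exact hcon ⟨[u, v], rfl, by simpa using huv, by simpa using not_lt.mp hge⟩
  have hsum := h (s - l) (2 * l - s) (by omega)
  have hrev : ∑ i ∈ range (2 * l - s + 1), θ (l - i) =
      ∑ i ∈ range (2 * l - s + 1), θ (s - l + i) := by
    rw [← sum_range_reflect]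
    refine sum_congr rfl fun i hi => ?_
    rw [mem_range] at hi
    congr 1; omega
  have : ∑ i ∈ range (2 * l - s + 1), (θ (s - l + i) + θ (l - i)) < 0 := by
    refine sum_neg (fun i hi => ?_) ⟨0, by simp⟩
    rw [mem_range] at hi
    exact hneg _ _ (by omega)
  rw [sum_add_distrib, hrev] at this
  linarith

/-- Let `c + y = j`. If `B` has nonnegative sum over the possible totals, from `c` to `(K + 1) j`, of
`K + 1` numbers of which one lies in `[c, j]` and the others in `[0, j]`, then some `K + 1` numbers
with such a total `c + i` satisfy `0 ≤ B (c + i) + ∑ θ`. One summand is split off at a time by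
`lattice_path_sum_nonneg`. -/
theorem exists_small_tuple {θ : ℕ → ℝ} {j : ℕ} (h : SuffixNonneg θ j) (K : ℕ) :
    ∀ (B : ℕ → ℝ) (c y : ℕ), c + y = j →
      0 ≤ ∑ i ∈ range (y + K * j + 1), B (c + i) →
      ∃ i ≤ y + K * j, ∃ a : List ℕ, a.length = K + 1 ∧ a.sum = c + i ∧
        0 ≤ B (c + i) + (a.map θ).sum := by
  induction K with
  | zero =>
    intro B c y hcy hB
    by_contra! hcon
    have : ∑ i ∈ range (y + 1), (B (c + i) + θ (c + i)) < 0 := by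
      refine sum_neg (fun i hi => ?_) ⟨0, by simp⟩
      rw [mem_range] at hi
      simpa using hcon i (by omega) [c + i] rfl (by simp)
    rw [sum_add_distrib] at this
    have := h c y hcy
    simp only [zero_mul, add_zero] at hB
    linarith
  | succ K ih =>
    intro B c y hcy hB
    have hmax : ∀ x, ∃ v ≤ j, ∀ v' ≤ j, B (x + v') + θ v' ≤ B (x + v) + θ v := by
      intro x
      obtain ⟨v, hv, hv'⟩ := exists_max_image (range (j + 1)) (fun v => B (x + v) + θ v)
        ⟨0, by simp⟩
      rw [mem_range] at hv
      exact ⟨v, by omega, fun v' h' => hv' v' (by rw [mem_range]; omega)⟩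
    choose g hgj hg using hmax
    obtain ⟨i, hi, a, ha1, ha2, ha3⟩ := ih (fun x => B (x + g x) + θ (g x)) c y hcy (by
      have := lattice_path_sum_nonneg _ (y + K * j) j rfl
        (fun i => B (c + i + g (c + i)) + θ (g (c + i))) (fun v => - θ v) (fun i => - B (c + i))
        (by
          intro x hx v hv
          have := hg (c + x) v hv
          rw [add_assoc c x v] at this
          linarith)
      rw [sum_neg_distrib, sum_neg_distrib] at this
      have h0 := h 0 j (by omega)
      simp only [zero_add] at h0
      rw [show y + K * j + j = y + (K + 1) * j by ring] at this
      have h3 : (0 : ℝ) ≤ (((y + K * j : ℕ) : ℝ) + j + 1) / (j + 1) * ∑ i ∈ range (j + 1), θ i :=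
        mul_nonneg (by positivity) h0
      have h4 : (0 : ℝ) < (((y + K * j : ℕ) : ℝ) + j + 1) / ((y + K * j : ℕ) + 1) := by positivity
      by_contra hneg
      have := mul_neg_of_pos_of_neg h4 (not_le.mp hneg)
      linarith)
    have := hgj (c + i)
    refine ⟨i + g (c + i), by nlinarith, g (c + i) :: a, by simp [ha1], by simp [ha2]; ring, ?_⟩
    simp only [List.map_cons, List.sum_cons]
    rw [← add_assoc c]
    linarith

/-- One entry runs over an interval ending at `l`, the other `K + 1` over intervals ending at `j`. -/
theorem hasGoodTuple_high {θ : ℕ → ℝ} {j l s K : ℕ} (hj : SuffixNonneg θ j)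
    (hl : SuffixNonneg θ l) (h1 : l ≤ s) (h2 : s ≤ l + j) (h3 : (K + 1) * j ≤ s) :
    HasGoodTuple θ (K + 2) s := by
  have hKj : (K + 1) * j = K * j + j := by ring
  obtain ⟨i, hi, a, ha1, ha2, ha3⟩ := exists_small_tuple hj K (fun c => θ (s - c)) (s - l)
    (l + j - s) (by omega) (by
      have := hl (s - (K + 1) * j) (l + (K + 1) * j - s) (by omega)
      rw [← sum_range_reflect] at this
      convert this using 1
      rw [show l + (K + 1) * j - s + 1 = l + j - s + K * j + 1 by omega]
      refine sum_congr rfl fun i hi => ?_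
      rw [mem_range] at hi
      congr 1; omega)
  refine ⟨(s - (s - l + i)) :: a, by simp [ha1], ?_, by simpa using ha3⟩
  simp only [List.sum_cons, ha2]
  omega

/-- Three entries from `[0, j]` with total `s = j + b`: with `x = j - Y - Z` decreasing along a lattice
path, `b + Y` covers `[b, j]` and `Z` covers `[0, b - 1]`, and together they cover `[0, j]` with at
least as much weight on `[b, j]`. When `j = 2 b` the value `b` is left out and compensated by the
triples `(b, b, b)` and `(j, b, 0)`. -/
theorem hasGoodTuple_three_low {θ : ℕ → ℝ} {j s : ℕ} (hj : SuffixNonneg θ j)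
    (h1 : 3 * j ≤ 2 * s) (h2 : s < 2 * j) : HasGoodTuple θ 3 s := by
  by_contra hcon
  have hneg : ∀ u v w, u + v + w = s → θ u + θ v + θ w < 0 := by
    intro u v w huv
    by_contra hge
    refine hcon ⟨[u, v, w], rfl, by simp [← huv, add_assoc], ?_⟩
    simp only [List.map_cons, List.map_nil, List.sum_cons, List.sum_nil, add_zero]
    linarith
  obtain ⟨b, rfl⟩ : ∃ b, s = j + b := ⟨s - j, by omega⟩
  have hb : 1 ≤ b := by omega
  have hS : 0 ≤ ∑ i ∈ range (j + 1), θ i := by simpa using hj 0 j (by omega)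
  have hS1 : 0 ≤ ∑ i ∈ range j, θ (i + 1) := by
    have := hj 1 (j - 1) (by omega)
    rw [show j - 1 + 1 = j by omega] at this
    simpa [add_comm] using this
  have hSb := hj b (j - b) (by omega)
  have hsplit : ∑ i ∈ range (j + 1), θ i =
      ∑ i ∈ range b, θ i + ∑ i ∈ range (j - b + 1), θ (b + i) := by
    rw [← sum_range_add]; congr 2; omega
  rcases Nat.lt_or_ge j (2 * b) with hjb | hjb
  · have := lattice_path_sum_pos (p := j - b) (q := b - 1) (F := fun y => - θ (b + y))
      (G := fun z => - θ z) (H := fun c => - θ (j - c)) (by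
        intro x hx y hy
        have := hneg (b + x) y (j - (x + y)) (by omega)
        linarith)
    have e1 : ((j - b : ℕ) : ℝ) + (b - 1 : ℕ) + 1 = j := by
      have : j - b + (b - 1) + 1 = j := by omega
      exact_mod_cast this
    have e2 : ((b - 1 : ℕ) : ℝ) + 1 = b := by
      have : b - 1 + 1 = b := by omega
      exact_mod_cast this
    have e3 : ∑ c ∈ range j, θ (j - c) = ∑ i ∈ range j, θ (i + 1) := by
      rw [← sum_range_reflect]
      refine sum_congr rfl fun i hi => ?_
      rw [mem_range] at hi
      congr 1; omega
    rw [sum_neg_distrib, sum_neg_distrib, sum_neg_distrib, e1, e2, show b - 1 + 1 = b by omega,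
      show j - b + (b - 1) + 1 = j by omega, e3] at this
    have hw : (j : ℝ) / b ≤ (j : ℝ) / ((j - b : ℕ) + 1) := by
      apply div_le_div_of_nonneg_left (by positivity) (by positivity)
      have : j - b + 1 ≤ b := by omega
      exact_mod_cast this
    have h3 := mul_nonneg (sub_nonneg.mpr hw) hSb
    have h4 := mul_nonneg (show 0 ≤ (j : ℝ) / b by positivity) hS
    rw [hsplit] at h4
    nlinarith
  · obtain rfl : j = 2 * b := by omega
    have hbb := hneg b b b (by omega)
    have hends := hneg (2 * b) b 0 (by omega)
    have := lattice_path_sum_pos (p := b - 1) (q := b - 1) (F := fun y => - θ (b + (y + 1)))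
      (G := fun z => - θ z) (H := fun c => - θ (2 * b - 1 - c)) (by
        intro x hx y hy
        have := hneg (b + (x + 1)) y (2 * b - 1 - (x + y)) (by omega)
        linarith)
    have e2 : ((b - 1 : ℕ) : ℝ) = b - 1 := by
      rw [Nat.cast_sub hb, Nat.cast_one]
    have e3 : ∑ c ∈ range (2 * b - 1), θ (2 * b - 1 - c) = ∑ i ∈ range (2 * b - 1), θ (i + 1) := by
      rw [← sum_range_reflect]
      refine sum_congr rfl fun i hi => ?_
      rw [mem_range] at hi
      congr 1; omega
    rw [sum_neg_distrib, sum_neg_distrib, sum_neg_distrib, e2, show b - 1 + 1 = b by omega,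
      show b - 1 + (b - 1) + 1 = 2 * b - 1 by omega, e3] at this
    rw [show 2 * b - b + 1 = b + 1 by omega, sum_range_succ' (fun i => θ (b + i)), add_zero] at hsplit
    have e4 : ∑ i ∈ range (2 * b + 1), θ i =
        ∑ i ∈ range (2 * b - 1), θ (i + 1) + θ (2 * b) + θ 0 := by
      rw [sum_range_succ', show 2 * b = 2 * b - 1 + 1 by omega, sum_range_succ]
      simp
    have hb' : (1 : ℝ) ≤ b := by exact_mod_cast hb
    set w : ℝ := ((b : ℝ) - 1 + (b - 1) + 1) / (b - 1 + 1) with hw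
    have hw1 : 1 ≤ w := by
      rw [hw, le_div_iff₀ (by linarith)]; linarith
    have h5 : 0 ≤ w * ∑ i ∈ range (2 * b + 1), θ i := mul_nonneg (by linarith) hS
    have h6 : 0 ≤ (w - 1) * (- θ b) := mul_nonneg (by linarith) (by linarith)
    rw [hsplit] at h5
    nlinarith

/-- If all sums of `θ` over intervals ending at `j` and over intervals ending at `l` are
nonnegative, then every admissible total `s` is attained by a `k`-tuple on which `θ` has
nonnegative total. -/
theorem hasGoodTuple_of_suffixNonneg {θ : ℕ → ℝ} {j : ℕ} (hj : SuffixNonneg θ j) (k : ℕ) :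
    ∀ (l s : ℕ), SuffixNonneg θ l → 2 ≤ k → j ≤ l → l ≤ s → s ≤ k * l → k * j ≤ 2 * s →
      HasGoodTuple θ k s := by
  induction k using Nat.strong_induction_on with
  | _ k ih =>
  intro l s hl hk hjl hls hsl hjs
  obtain rfl | rfl | hk4 : k = 2 ∨ k = 3 ∨ 4 ≤ k := by omega
  · exact hasGoodTuple_two hl hls hsl
  · rcases Nat.lt_or_ge s (l + j) with h1 | h1
    · rcases Nat.lt_or_ge s (2 * j) with h2 | h2
      · exact hasGoodTuple_three_low hj hjs h2
      · exact hasGoodTuple_high (K := 1) hj hl hls h1.le (by omega)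
    · rcases Nat.lt_or_ge s (2 * l) with h2 | h2
      · have := (hasGoodTuple_two (s := s - j) hl (by omega) (by omega)).cons hj.apply_nonneg
        rwa [Nat.add_sub_cancel' (by omega)] at this
      · have := (hasGoodTuple_two (s := s - l) hl (by omega) (by omega)).cons hl.apply_nonneg
        rwa [Nat.add_sub_cancel' (by omega)] at this
  · obtain ⟨k, rfl⟩ : ∃ k', k = k' + 4 := ⟨k - 4, by omega⟩
    have hlow : ∀ l s, SuffixNonneg θ l → j ≤ l → l + j ≤ s → s ≤ (k + 4) * l →
        (k + 4) * j ≤ 2 * s → HasGoodTuple θ (k + 4) s := by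
      intro l s hl hjl hls hsl hjs
      rcases Nat.lt_or_ge ((k + 2) * l) (s - j) with h2 | h2
      · have := (ih (k + 3) (by omega) l (s - l) hl (by omega) hjl (by
          have : 2 * l ≤ (k + 2) * l := Nat.mul_le_mul_right _ (by omega)
          omega)
          (by rw [tsub_le_iff_right]; nlinarith) (by
            have h3 : (k + 2) * l + j < s := by omega
            have h4 : (k + 1) * l + j ≤ s - l := by
              apply Nat.le_sub_of_add_le; nlinarith
            nlinarith)).cons hl.apply_nonneg
        rwa [Nat.add_sub_cancel' (by omega)] at this
      · have := (hasGoodTuple_two (s := j) hj le_rfl (by omega)).append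
          (ih (k + 2) (by omega) l (s - j) hl (by omega) hjl (by omega) h2 (by
            have : s = (s - j) + j := by omega
            nlinarith))
        rwa [Nat.add_sub_cancel' (by omega), add_comm 2] at this
    rcases Nat.lt_or_ge s (l + j) with h1 | h1
    · rcases Nat.lt_or_ge ((k + 4) * j) s with h2 | h2
      · exact hasGoodTuple_high (K := k + 2) hj hl hls h1.le (by nlinarith)
      · exact hlow j s hj le_rfl (by nlinarith) h2 hjs
    · exact hlow l s hl hjl h1 hsl hjs

/-! ### Decreasing distributions of mean `M / k` -/

theorem sum_range_slope (k M : ℝ) (x : ℕ) :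
    ∑ v ∈ range (x + 1), (k * v - M) = ((x : ℝ) + 1) * (k * x - 2 * M) / 2 := by
  induction x with
  | zero => simp; ring
  | succ x ih => rw [sum_range_succ, ih]; push_cast; ring

/-- A position where the prefix sums attain a nonnegative maximum has nonnegative suffix sums. -/
theorem suffixNonneg_of_prefix_le {θ : ℕ → ℝ} {j : ℕ} {h : ℝ} (hh : 0 ≤ h)
    (hj : ∑ v ∈ range (j + 1), θ v = h) (hx : ∀ x ≤ j, ∑ v ∈ range (x + 1), θ v ≤ h) :
    SuffixNonneg θ j := by
  rintro (_ | x) y rfl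
  · simp only [zero_add] at hj ⊢
    linarith
  · have := hx x (by omega)
    rw [add_assoc, sum_range_add] at hj
    linarith

/-- The tilt by which the prefix sums up to `2M/k` and those from `2M/k` on have the same
maximum. -/
theorem exists_balanced_slope {k M : ℕ} (hk : 3 ≤ k) (hM : 1 ≤ M) (θ : ℕ → ℝ) :
    ∃ (α h : ℝ) (j l : ℕ), j ≤ M ∧ l ≤ M ∧ k * j ≤ 2 * M ∧ 2 * M ≤ k * l ∧
      ∑ v ∈ range (j + 1), (θ v - α * ((k : ℝ) * v - M)) = h ∧
      ∑ v ∈ range (l + 1), (θ v - α * ((k : ℝ) * v - M)) = h ∧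
      ∀ x ≤ M, ∑ v ∈ range (x + 1), (θ v - α * ((k : ℝ) * v - M)) ≤ h := by
  set A : ℕ → ℝ := fun x => ∑ v ∈ range (x + 1), θ v with hA
  set B : ℕ → ℝ := fun x => ∑ v ∈ range (x + 1), ((k : ℝ) * v - M) with hB
  have hAB : ∀ α x, ∑ v ∈ range (x + 1), (θ v - α * ((k : ℝ) * v - M)) = A x - α * B x := by
    intro α x
    rw [sum_sub_distrib, ← mul_sum]
  simp only [hAB]
  set S₁ := (range (M + 1)).filter (fun x => k * x ≤ 2 * M) with hS₁
  set S₂ := (range (M + 1)).filter (fun x => 2 * M ≤ k * x) with hS₂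
  have h0 : 0 ∈ S₁ := by simp [hS₁]
  have hMS : M ∈ S₂ := by simp [hS₂]; nlinarith
  have hBeq : ∀ x, B x = ((x : ℝ) + 1) * (k * x - 2 * M) / 2 := fun x => sum_range_slope _ _ x
  have hB₁ : ∀ x ∈ S₁, B x ≤ 0 := by
    intro x hx
    have : (k : ℝ) * x ≤ 2 * M := by exact_mod_cast (mem_filter.mp hx).2
    rw [hBeq]
    have := mul_nonneg (show (0 : ℝ) ≤ x + 1 by positivity) (sub_nonneg.mpr this)
    linarith
  have hB₂ : ∀ x ∈ S₂, 0 ≤ B x := by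
    intro x hx
    have : 2 * (M : ℝ) ≤ k * x := by exact_mod_cast (mem_filter.mp hx).2
    rw [hBeq]
    have := mul_nonneg (show (0 : ℝ) ≤ x + 1 by positivity) (sub_nonneg.mpr this)
    linarith
  have hM1 : (1 : ℝ) ≤ M := by exact_mod_cast hM
  have hB0 : B 0 = - M := by simp [hB]
  have hBM : 1 ≤ B M := by
    have : (3 : ℝ) ≤ k := by exact_mod_cast hk
    rw [hBeq]
    nlinarith [mul_nonneg (sub_nonneg.mpr this) (sub_nonneg.mpr hM1)]
  set P : ℝ → ℝ := fun α => S₁.sup' ⟨0, h0⟩ (fun x => A x - α * B x) with hP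
  set Q : ℝ → ℝ := fun α => S₂.sup' ⟨M, hMS⟩ (fun x => A x - α * B x) with hQ
  have hPc : Continuous P := Continuous.finset_sup'_apply _ (fun x _ => by fun_prop)
  have hQc : Continuous Q := Continuous.finset_sup'_apply _ (fun x _ => by fun_prop)
  set C : ℝ := ∑ x ∈ range (M + 1), |A x| with hC
  have hCA : ∀ x ∈ range (M + 1), |A x| ≤ C := fun x hx =>
    single_le_sum (f := fun x => |A x|) (fun _ _ => abs_nonneg _) hx
  have hC0 : 0 ≤ C := sum_nonneg fun _ _ => abs_nonneg _
  have hlo : P (-(2 * C)) ≤ Q (-(2 * C)) := by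
    refine (sup'_le _ _ (a := C) fun x hx => ?_).trans
      (le_trans ?_ (le_sup' (fun x => A x - -(2 * C) * B x) hMS))
    · have := (abs_le.mp (hCA x (mem_filter.mp hx).1)).2
      nlinarith [hB₁ x hx]
    · have := (abs_le.mp (hCA M (by simp))).1
      nlinarith
  have hhi : Q (2 * C) ≤ P (2 * C) := by
    refine (sup'_le _ _ (a := C) fun x hx => ?_).trans
      (le_trans ?_ (le_sup' (fun x => A x - (2 * C) * B x) h0))
    · have := (abs_le.mp (hCA x (mem_filter.mp hx).1)).2
      nlinarith [hB₂ x hx]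
    · have := (abs_le.mp (hCA 0 (by simp))).1
      rw [hB0]
      nlinarith
  obtain ⟨α, hα⟩ := intermediate_value_univ₂ hPc hQc hlo hhi
  obtain ⟨j, hj, hj'⟩ := exists_mem_eq_sup' ⟨0, h0⟩ (fun x => A x - α * B x)
  obtain ⟨l, hl, hl'⟩ := exists_mem_eq_sup' ⟨M, hMS⟩ (fun x => A x - α * B x)
  refine ⟨α, P α, j, l, ?_, ?_, (mem_filter.mp hj).2, (mem_filter.mp hl).2, hj'.symm,
    by rw [hα]; exact hl'.symm, fun x hx => ?_⟩
  · have := (mem_filter.mp hj).1; rw [mem_range] at this; omega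
  · have := (mem_filter.mp hl).1; rw [mem_range] at this; omega
  · have hxr : x ∈ range (M + 1) := by rw [mem_range]; omega
    rcases le_total (k * x) (2 * M) with h | h
    · exact le_sup' (fun x => A x - α * B x) (mem_filter.mpr ⟨hxr, h⟩)
    · rw [hα]
      exact le_sup' (fun x => A x - α * B x) (mem_filter.mpr ⟨hxr, h⟩)

theorem list_map_tilt_sum (θ : ℕ → ℝ) (α k M : ℝ) (a : List ℕ) :
    (a.map fun v => θ v - α * (k * v - M)).sum =
      (a.map θ).sum - α * (k * (a.sum : ℝ) - a.length * M) := by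
  induction a with
  | nil => simp
  | cons v a ih => simp only [List.map_cons, List.sum_cons, ih, List.length_cons]; push_cast; ring

/-- If the prefix sums had a nonnegative maximum, attained on both sides of `2M/k`, then
`hasGoodTuple_of_suffixNonneg` would give a tuple contradicting the hypothesis. The tilt is
invisible on tuples of length `k` and sum `M`. -/
theorem balanced_max_neg {k M : ℕ} (hk : 3 ≤ k) {θ : ℕ → ℝ}
    (hθ : ∀ a : List ℕ, a.length = k → a.sum = M → (a.map θ).sum < 0)
    {α h : ℝ} {j l : ℕ} (hjM : j ≤ M) (hlM : l ≤ M) (hj2 : k * j ≤ 2 * M) (hl2 : 2 * M ≤ k * l)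
    (hj : ∑ v ∈ range (j + 1), (θ v - α * ((k : ℝ) * v - M)) = h)
    (hl : ∑ v ∈ range (l + 1), (θ v - α * ((k : ℝ) * v - M)) = h)
    (hx : ∀ x ≤ M, ∑ v ∈ range (x + 1), (θ v - α * ((k : ℝ) * v - M)) ≤ h) : h < 0 := by
  by_contra! hh
  have sj := suffixNonneg_of_prefix_le hh hj (fun x hxj => hx x (hxj.trans hjM))
  have sl := suffixNonneg_of_prefix_le hh hl (fun x hxl => hx x (hxl.trans hlM))
  obtain ⟨a, ha1, ha2, ha3⟩ := hasGoodTuple_of_suffixNonneg sj k l M sl (by omega)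
    (Nat.le_of_mul_le_mul_left (hj2.trans hl2) (by omega)) hlM (by nlinarith) hj2
  rw [list_map_tilt_sum, ha1, ha2] at ha3
  have := hθ a ha1 ha2
  rw [sub_self, mul_zero] at ha3
  linarith

/-- The non-strict version of `balanced_max_neg`, for a suitable tilt. A positive common maximum `h`
would be at least `h` for every other tilt, and so would survive lowering `θ` by a small constant. -/
theorem exists_slope_prefix_nonpos {k M : ℕ} (hk : 3 ≤ k) (hM : 1 ≤ M) {θ : ℕ → ℝ}
    (hθ : ∀ a : List ℕ, a.length = k → a.sum = M → (a.map θ).sum ≤ 0) :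
    ∃ α : ℝ, ∀ x ≤ M, ∑ v ∈ range (x + 1), (θ v - α * ((k : ℝ) * v - M)) ≤ 0 := by
  obtain ⟨α, h, j, l, hjM, hlM, hj2, hl2, hj, hl, hx⟩ := exists_balanced_slope hk hM θ
  refine ⟨α, fun x hxM => (hx x hxM).trans ?_⟩
  by_contra! hh
  set δ : ℝ := h / (M + 1) with hδ
  have hδ0 : 0 < δ := by positivity
  obtain ⟨β, h', j', l', hjM', hlM', hj2', hl2', hj', hl', hx'⟩ :=
    exists_balanced_slope hk hM (fun v => θ v - δ)
  have hneg := balanced_max_neg hk (θ := fun v => θ v - δ) (by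
    intro a ha1 ha2
    have h1 := hθ a ha1 ha2
    have h2 := list_map_tilt_sum θ δ 0 (-1) a
    have h3 : (0 : ℝ) < a.length * δ := by
      rw [ha1]
      have : 0 < k := by omega
      positivity
    simp only [zero_mul, zero_sub, neg_neg, mul_one] at h2
    rw [h2]
    linarith) hjM' hlM' hj2' hl2' hj' hl' hx'
  have hlt : ∀ x ≤ M, ∑ v ∈ range (x + 1), (θ v - β * ((k : ℝ) * v - M)) < h := by
    intro x hxM
    have h1 := hx' x hxM
    have h2 : ∑ v ∈ range (x + 1), (θ v - δ - β * ((k : ℝ) * v - M)) =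
        ∑ v ∈ range (x + 1), (θ v - β * ((k : ℝ) * v - M)) - (x + 1) * δ := by
      rw [eq_sub_iff_add_eq, show ((x : ℝ) + 1) * δ = ∑ v ∈ range (x + 1), δ by simp,
        ← sum_add_distrib]
      exact sum_congr rfl fun v _ => by ring
    have h3 : ((x : ℝ) + 1) * δ ≤ h := by
      have : ((x : ℝ) + 1) ≤ M + 1 := by exact_mod_cast Nat.succ_le_succ hxM
      calc ((x : ℝ) + 1) * δ ≤ (M + 1) * δ := by gcongr
        _ = h := by rw [hδ]; field_simp
    linarith
  have hsplit : ∀ (γ : ℝ) x, ∑ v ∈ range (x + 1), (θ v - γ * ((k : ℝ) * v - M)) =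
      ∑ v ∈ range (x + 1), θ v - γ * (((x : ℝ) + 1) * (k * x - 2 * M) / 2) := by
    intro γ x
    rw [sum_sub_distrib, ← mul_sum, sum_range_slope]
  rcases le_total α β with hαβ | hαβ
  · have h1 := hlt j hjM
    rw [hsplit] at h1 hj
    have : (k : ℝ) * j ≤ 2 * M := by exact_mod_cast hj2
    have := mul_nonneg (mul_nonneg (sub_nonneg.mpr hαβ) (show (0 : ℝ) ≤ j + 1 by positivity))
      (sub_nonneg.mpr this)
    linarith
  · have h1 := hlt l hlM
    rw [hsplit] at h1 hl
    have : 2 * (M : ℝ) ≤ k * l := by exact_mod_cast hl2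
    have := mul_nonneg (mul_nonneg (sub_nonneg.mpr hαβ) (show (0 : ℝ) ≤ l + 1 by positivity))
      (sub_nonneg.mpr this)
    linarith

/-- A function `θ` that is nonpositive in total on all `k`-tuples of sum `M` has nonpositive mean under
every strictly decreasing `ψ` of mean `M / k`, with equality only for multiples of `k v - M`. By
convex duality this says that `ψ` is interior to the set of averaged marginals of distributions
on such tuples. -/
theorem decreasing_mean_le {k M : ℕ} (hk : 3 ≤ k) (hM : 1 ≤ M) {ψ : ℕ → ℝ}
    (hψM : 0 < ψ M) (hψ : ∀ v < M, ψ (v + 1) < ψ v)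
    (hmean : ∑ v ∈ range (M + 1), ψ v * ((k : ℝ) * v - M) = 0) {θ : ℕ → ℝ}
    (hθ : ∀ a : List ℕ, a.length = k → a.sum = M → (a.map θ).sum ≤ 0) :
    ∑ v ∈ range (M + 1), ψ v * θ v ≤ 0 ∧
      (∑ v ∈ range (M + 1), ψ v * θ v = 0 →
        ∃ α : ℝ, ∀ v ≤ M, θ v = α * ((k : ℝ) * v - M)) := by
  obtain ⟨α, hα⟩ := exists_slope_prefix_nonpos hk hM hθ
  have h1 : ∑ v ∈ range (M + 1), ψ v * θ v =
      ∑ v ∈ range (M + 1), ψ v • (θ v - α * ((k : ℝ) * v - M)) := by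
    have : ∑ v ∈ range (M + 1), ψ v • (θ v - α * ((k : ℝ) * v - M)) =
      ∑ v ∈ range (M + 1), ψ v * θ v - α * ∑ v ∈ range (M + 1), ψ v * ((k : ℝ) * v - M) := by
      rw [mul_sum, ← sum_sub_distrib]
      exact sum_congr rfl fun v _ => by rw [smul_eq_mul]; ring
    rw [this, hmean]; ring
  rw [sum_range_by_parts] at h1
  simp only [Nat.add_sub_cancel, smul_eq_mul] at h1
  have h2 : ∀ i ∈ range M, 0 ≤ (ψ (i + 1) - ψ i) *
      ∑ v ∈ range (i + 1), (θ v - α * ((k : ℝ) * v - M)) := by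
    intro i hi
    rw [mem_range] at hi
    exact mul_nonneg_of_nonpos_of_nonpos (by linarith [hψ i hi]) (hα i hi.le)
  have h3 := sum_nonneg h2
  have h4 : ψ M * ∑ v ∈ range (M + 1), (θ v - α * ((k : ℝ) * v - M)) ≤ 0 :=
    mul_nonpos_of_nonneg_of_nonpos hψM.le (hα M le_rfl)
  refine ⟨by linarith, fun h0 => ⟨α, ?_⟩⟩
  have h5 : ∀ x ≤ M, ∑ v ∈ range (x + 1), (θ v - α * ((k : ℝ) * v - M)) = 0 := by
    intro x hx
    rcases hx.lt_or_eq with hx | rfl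
    · have := (sum_eq_zero_iff_of_nonneg h2).mp (by linarith) x (mem_range.mpr hx)
      exact (mul_eq_zero.mp this).resolve_left (by linarith [hψ x hx])
    · exact (mul_eq_zero.mp (by linarith : ψ x * ∑ v ∈ range (x + 1),
        (θ v - α * ((k : ℝ) * v - x)) = 0)).resolve_left hψM.ne'
  intro v hv
  have h6 := h5 v hv
  rw [sum_range_succ] at h6
  rcases Nat.eq_zero_or_pos v with rfl | hv0
  · simp only [range_zero, sum_empty] at h6
    linarith
  · have := h5 (v - 1) (by omega)
    rw [Nat.sub_add_cancel hv0] at this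
    linarith

/-! ### Product weights with prescribed marginals -/

/-- The `k`-tuples of elements of `{0, …, M}` with sum `M`. -/
abbrev Col (k M : ℕ) : Type := {a : Fin k → Fin (M + 1) // ∑ i, (a i : ℕ) = M}

/-- The total of `θ` over the entries of a tuple. -/
def entrySum {k M : ℕ} (θ : Fin (M + 1) → ℝ) (a : Col k M) : ℝ := ∑ i, θ (a.1 i)

/-- The tuple with `M` in position `i` and zeros elsewhere. -/
def Col.single {k M : ℕ} (i : Fin k) : Col k M :=
  ⟨Pi.single i (Fin.last M), by
    rw [Finset.sum_eq_single i]
    · simp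
    · intro b _ hb; simp [Pi.single_eq_of_ne hb]
    · simp⟩

theorem decreasing_mean_le_of_col {k M : ℕ} (hk : 3 ≤ k) (hM : 1 ≤ M) {ψ : ℕ → ℝ}
    (hψM : 0 < ψ M) (hψ : ∀ v < M, ψ (v + 1) < ψ v)
    (hmean : ∑ v ∈ range (M + 1), ψ v * ((k : ℝ) * v - M) = 0) {θ : Fin (M + 1) → ℝ}
    (hθ : ∀ a : Col k M, entrySum θ a ≤ 0) :
    ∑ v : Fin (M + 1), ψ v * θ v ≤ 0 ∧
      (∑ v : Fin (M + 1), ψ v * θ v = 0 →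
        ∃ α : ℝ, ∀ v : Fin (M + 1), θ v = α * ((k : ℝ) * v - M)) := by
  have key := decreasing_mean_le hk hM hψM hψ hmean (θ := fun n => θ (Fin.ofNat (M + 1) n)) (by
    intro a ha1 ha2
    have hle : ∀ v ∈ a, v < M + 1 := fun v hv =>
      Nat.lt_succ_of_le (ha2 ▸ List.le_sum_of_mem hv)
    subst ha1
    convert hθ ⟨fun i => ⟨a.get i, hle _ (a.get_mem i)⟩, by
      simp only [List.get_eq_getElem, ← ha2, Fin.sum_univ_getElem]⟩ using 1
    unfold entrySum
    rw [← Fin.sum_univ_fun_getElem]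
    refine sum_congr rfl fun i _ => ?_
    congr 1
    ext
    simp only [Fin.ofNat, List.get_eq_getElem]
    exact Nat.mod_eq_of_lt (hle _ (a.get_mem i)))
  have e : ∑ v ∈ range (M + 1), ψ v * θ (Fin.ofNat (M + 1) v) = ∑ v : Fin (M + 1), ψ v * θ v := by
    rw [← Fin.sum_univ_eq_sum_range (fun v => ψ v * θ (Fin.ofNat (M + 1) v))]
    exact sum_congr rfl fun v _ => by simp
  rw [e] at key
  refine ⟨key.1, fun h0 => ?_⟩
  obtain ⟨α, hα⟩ := key.2 h0
  refine ⟨α, fun v => ?_⟩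
  have := hα v (Nat.le_of_lt_succ v.2)
  simpa using this

/-- Every strictly decreasing distribution `ψ` on `{0, …, M}` of mean `M / k` is the averaged marginal
of a product-form distribution `∏ f(a_i)` on the `k`-tuples of sum `M`. Such an `f` is a critical
point of the convex functional `θ ↦ log ∑_a exp(∑ θ(a_i)) - k ∑ ψ θ`, which is coercive modulo
affine functions by `decreasing_mean_le_of_col`. -/
theorem exists_product_weights {k M : ℕ} (hk : 3 ≤ k) (hM : 1 ≤ M) {ψ : ℕ → ℝ}
    (hψM : 0 < ψ M) (hψ : ∀ v < M, ψ (v + 1) < ψ v)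
    (hψ1 : ∑ v : Fin (M + 1), ψ v = 1)
    (hmean : ∑ v ∈ range (M + 1), ψ v * ((k : ℝ) * v - M) = 0) :
    ∃ f : Fin (M + 1) → ℝ, (∀ v, 0 < f v) ∧
      ∀ v, ∑ a : Col k M, (∏ i, f (a.1 i)) * ∑ i, (if a.1 i = v then (1 : ℝ) else 0) = k * ψ v := by
  have hk0 : 0 < k := by omega
  have : Nonempty (Col k M) := ⟨Col.single ⟨0, hk0⟩⟩
  -- adding an affine function of the entry to `θ` changes nothing, so `θ 0 = θ M = 0` is a
  -- normalisation
  set E : Set (Fin (M + 1) → ℝ) := {θ | θ 0 = 0 ∧ θ (Fin.last M) = 0} with hE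
  have hEc : IsClosed E :=
    (isClosed_eq (continuous_apply _) continuous_const).inter
      (isClosed_eq (continuous_apply _) continuous_const)
  set lin : (Fin (M + 1) → ℝ) → ℝ := fun θ => k * ∑ v : Fin (M + 1), ψ v * θ v with hlin
  have hlinc : Continuous lin := by fun_prop
  have hsc : ∀ a : Col k M, Continuous fun θ => entrySum θ a := fun a => by
    unfold entrySum; fun_prop
  have hsmul : ∀ (r : ℝ) θ (a : Col k M), entrySum (r • θ) a = r * entrySum θ a := by
    intro r θ a; simp [entrySum, mul_sum]
  have hlsmul : ∀ (r : ℝ) θ, lin (r • θ) = r * lin θ := by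
    intro r θ
    simp only [hlin, Pi.smul_apply, smul_eq_mul, mul_sum]
    exact sum_congr rfl fun v _ => by ring
  have hadd : ∀ θ η (a : Col k M), entrySum (θ + η) a = entrySum θ a + entrySum η a := by
    intro θ η a; simp [entrySum, sum_add_distrib]
  have hladd : ∀ θ η, lin (θ + η) = lin θ + lin η := by
    intro θ η
    simp only [hlin, Pi.add_apply, mul_add, sum_add_distrib]
  set D : (Fin (M + 1) → ℝ) → ℝ := fun θ =>
    univ.sup' univ_nonempty (fun a : Col k M => entrySum θ a) - lin θ with hD
  have hDc : Continuous D :=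
    (Continuous.finset_sup'_apply _ (fun a _ => hsc a)).sub hlinc
  -- strict positivity of the gap away from the affine functions
  have hDpos : ∀ θ ∈ E, θ ≠ 0 → 0 < D θ := by
    intro θ hθ hne
    set T := univ.sup' univ_nonempty (fun a : Col k M => entrySum θ a) with hT
    have hkR : (k : ℝ) ≠ 0 := by positivity
    have hle : ∀ a : Col k M, entrySum (fun v => θ v - T / k) a ≤ 0 := by
      intro a
      have h1 : entrySum θ a ≤ T := le_sup' (fun a : Col k M => entrySum θ a) (mem_univ a)
      have h2 : entrySum (fun v => θ v - T / k) a = entrySum θ a - T := by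
        simp only [entrySum, sum_sub_distrib, sum_const, card_univ, Fintype.card_fin, nsmul_eq_mul]
        field_simp
      linarith
    obtain ⟨h1, h2⟩ := decreasing_mean_le_of_col hk hM hψM hψ hmean hle
    have h3 : ∑ v : Fin (M + 1), ψ v * (θ v - T / k) = (lin θ - T) / k := by
      simp only [hlin, mul_sub, sum_sub_distrib, ← sum_mul, hψ1]
      field_simp
    rw [h3] at h1 h2
    have hD' : D θ = T - lin θ := rfl
    have h4 : lin θ - T ≤ 0 := by
      by_contra hcon
      exact absurd h1 (not_le.mpr (div_pos (not_le.mp hcon) (by positivity)))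
    rcases h4.lt_or_eq with h5 | h5
    · linarith
    · exfalso
      obtain ⟨α, hα⟩ := h2 (by rw [h5, zero_div])
      have a0 := hα 0
      have aM := hα (Fin.last M)
      rw [hθ.1] at a0
      rw [hθ.2] at aM
      simp only [Fin.val_zero, Nat.cast_zero, mul_zero, Fin.val_last] at a0 aM
      have hα0 : α = 0 := by
        have : α * (k * M : ℝ) = 0 := by linarith
        have hkM : (k * M : ℝ) ≠ 0 := by positivity
        exact (mul_eq_zero.mp this).resolve_right hkM
      apply hne
      ext v
      have h6 := hα v
      rw [hα0] at a0 h6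
      simp only [Pi.zero_apply]
      linarith
  obtain ⟨c, hc0, hc⟩ : ∃ c : ℝ, 0 < c ∧ ∀ θ ∈ E, c * ‖θ‖ ≤ D θ := by
    have hK : IsCompact (Metric.sphere (0 : Fin (M + 1) → ℝ) 1 ∩ E) :=
      (isCompact_sphere _ _).inter_right hEc
    rcases (Metric.sphere (0 : Fin (M + 1) → ℝ) 1 ∩ E).eq_empty_or_nonempty with hemp | hne
    · refine ⟨1, one_pos, fun θ hθ => ?_⟩
      by_cases h0 : θ = 0
      · subst h0
        simp [hD, entrySum, hlin]
      · exfalso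
        have : ‖θ‖⁻¹ • θ ∈ Metric.sphere (0 : Fin (M + 1) → ℝ) 1 ∩ E := by
          refine ⟨by simp [norm_smul, h0], ?_, ?_⟩ <;> simp [hθ.1, hθ.2]
        rw [hemp] at this
        exact this
    · obtain ⟨θ₀, hθ₀, hmin⟩ := hK.exists_isMinOn hne hDc.continuousOn
      have hθ₀ne : θ₀ ≠ 0 := by
        rintro rfl
        simpa using hθ₀.1
      refine ⟨D θ₀, hDpos _ hθ₀.2 hθ₀ne, fun θ hθ => ?_⟩
      by_cases h0 : θ = 0
      · subst h0
        simp [hD, entrySum, hlin]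
      · have hn : 0 < ‖θ‖ := norm_pos_iff.mpr h0
        have hmem : ‖θ‖⁻¹ • θ ∈ Metric.sphere (0 : Fin (M + 1) → ℝ) 1 ∩ E := by
          refine ⟨by simp [norm_smul, h0], ?_, ?_⟩ <;> simp [hθ.1, hθ.2]
        have h1 : D θ₀ ≤ D (‖θ‖⁻¹ • θ) := hmin hmem
        have h2 : D (‖θ‖⁻¹ • θ) ≤ ‖θ‖⁻¹ * D θ := by
          simp only [hD, hlsmul, hsmul, mul_sub]
          refine sub_le_sub_right (sup'_le _ _ fun a _ => ?_) _
          exact mul_le_mul_of_nonneg_left (le_sup' (fun a : Col k M => entrySum θ a) (mem_univ a))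
            (by positivity)
        have := h1.trans h2
        rw [inv_mul_eq_div, le_div_iff₀ hn] at this
        exact this
  -- the convex functional whose critical points are the product weights
  set Z : (Fin (M + 1) → ℝ) → ℝ := fun θ => ∑ a : Col k M, Real.exp (entrySum θ a) with hZ
  have hZpos : ∀ θ, 0 < Z θ := fun θ => sum_pos (fun a _ => Real.exp_pos _) univ_nonempty
  set Φ : (Fin (M + 1) → ℝ) → ℝ := fun θ => Real.log (Z θ) - lin θ with hΦ
  have hΦc : Continuous Φ := by
    refine (Continuous.log ?_ fun θ => (hZpos θ).ne').sub hlinc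
    exact continuous_finsetSum _ fun a _ => Real.continuous_exp.comp (hsc a)
  have hDΦ : ∀ θ, D θ ≤ Φ θ := by
    intro θ
    refine sub_le_sub_right (sup'_le _ _ fun a _ => ?_) _
    rw [Real.le_log_iff_exp_le (hZpos θ)]
    exact single_le_sum (f := fun a : Col k M => Real.exp (entrySum θ a))
      (fun _ _ => (Real.exp_pos _).le) (mem_univ a)
  have h0E : (0 : Fin (M + 1) → ℝ) ∈ E := ⟨rfl, rfl⟩
  obtain ⟨θ, hθE, hθ⟩ := hΦc.continuousOn.exists_isMinOn' hEc h0E (by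
    have h1 : ∀ᶠ θ in Filter.cocompact (Fin (M + 1) → ℝ), Φ 0 / c ≤ ‖θ‖ :=
      tendsto_norm_cocompact_atTop.eventually_ge_atTop _
    rw [Filter.eventually_inf_principal]
    filter_upwards [h1] with θ h2 hθ
    rw [div_le_iff₀ hc0] at h2
    linarith [hc θ hθ, hDΦ θ])
  set π : Col k M → ℝ := fun a => Real.exp (entrySum θ a) / Z θ with hπ
  have hπ1 : ∑ a, π a = 1 := by
    rw [hπ, ← sum_div]; exact div_self (hZpos θ).ne'
  -- the derivative vanishes in the directions of `E`, and in the affine directions by the mean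
  -- condition
  have hcritE : ∀ η ∈ E, ∑ a, π a * entrySum η a = lin η := by
    intro η hη
    have hder : HasDerivAt (fun t : ℝ => Φ (θ + t • η))
        ((∑ a : Col k M, Real.exp (entrySum θ a) * entrySum η a) / Z θ - lin η) 0 := by
      have e : (fun t : ℝ => Φ (θ + t • η)) = fun t =>
          Real.log (∑ a : Col k M, Real.exp (entrySum θ a + t * entrySum η a)) - (lin θ + t * lin η) := by
        ext t
        simp only [hΦ, hZ, hadd, hladd, hsmul, hlsmul]
      rw [e]
      have h1 : ∀ a : Col k M, HasDerivAt (fun t : ℝ =>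
          Real.exp (entrySum θ a + t * entrySum η a))
          (Real.exp (entrySum θ a) * entrySum η a) 0 := by
        intro a
        have := (((hasDerivAt_id (0 : ℝ)).mul_const (entrySum η a)).const_add
          (entrySum θ a)).exp
        simpa using this
      have h2 := HasDerivAt.fun_sum (u := univ) fun a _ => h1 a
      have h3 := h2.log (by simpa using (hZpos θ).ne')
      have h4 := h3.fun_sub (((hasDerivAt_id (0 : ℝ)).mul_const (lin η)).const_add (lin θ))
      simpa using h4
    have hmin : IsLocalMin (fun t : ℝ => Φ (θ + t • η)) 0 := by
      refine Filter.Eventually.of_forall fun t => ?_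
      simp only [zero_smul, add_zero]
      refine hθ ⟨?_, ?_⟩ <;> simp [hθE.1, hθE.2, hη.1, hη.2]
    have h5 := hmin.hasDerivAt_eq_zero hder
    rw [sub_eq_zero] at h5
    rw [← h5, sum_div]
    exact sum_congr rfl fun a _ => by rw [hπ]; ring
  have hcrit : ∀ η, ∑ a, π a * entrySum η a = lin η := by
    intro η
    set β := (η (Fin.last M) - η 0) / M with hβ
    have hMR : (M : ℝ) ≠ 0 := by positivity
    have h1 := hcritE (fun v => η v - η 0 - β * v) ⟨by simp, by
      simp only [Fin.val_last, hβ]; field_simp; ring⟩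
    have h2 : ∀ a : Col k M, entrySum (fun v => η v - η 0 - β * v) a =
        entrySum η a - k * η 0 - β * M := by
      intro a
      simp only [entrySum, sum_sub_distrib, sum_const, card_univ, Fintype.card_fin, nsmul_eq_mul,
        ← mul_sum]
      have := a.2
      have : ∑ i, ((a.1 i : ℕ) : ℝ) = M := by exact_mod_cast this
      rw [this]
    have h3 : lin (fun v => η v - η 0 - β * v) = lin η - k * η 0 - β * M := by
      have h4 : k * ∑ v : Fin (M + 1), ψ v * (v : ℕ) = M := by
        rw [← Fin.sum_univ_eq_sum_range (fun v => ψ v * ((k : ℝ) * v - M))] at hmean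
        simp only [mul_sub, sum_sub_distrib, ← sum_mul, hψ1] at hmean
        rw [mul_sum, ← sub_eq_zero, ← hmean, one_mul]
        congr 1
        exact sum_congr rfl fun v _ => by ring
      have h5 : ∑ v : Fin (M + 1), ψ v * (β * (v : ℕ)) = β * ∑ v : Fin (M + 1), ψ v * (v : ℕ) := by
        rw [mul_sum]; exact sum_congr rfl fun v _ => by ring
      simp only [hlin, mul_sub, sum_sub_distrib, ← sum_mul, hψ1, h5]
      rw [← h4]; ring
    simp only [h2, h3, mul_sub, sum_sub_distrib, ← sum_mul, hπ1] at h1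
    linarith
  refine ⟨fun v => Real.exp (θ v) * (Z θ) ^ (-(1 : ℝ) / k), fun v => by
    have := hZpos θ; positivity, fun v => ?_⟩
  have h1 := hcrit (fun u => if u = v then 1 else 0)
  simp only [hlin, mul_ite, mul_one, mul_zero, sum_ite_eq', mem_univ, if_true] at h1
  rw [← h1]
  refine sum_congr rfl fun a _ => ?_
  congr 1
  rw [prod_mul_distrib, prod_const, card_univ, Fintype.card_fin, ← Real.exp_sum,
    ← Real.rpow_natCast, ← Real.rpow_mul (hZpos θ).le]
  have : (-(1 : ℝ) / k) * k = -1 := by field_simp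
  rw [this, Real.rpow_neg_one, hπ]
  rfl

/-! ### Entropy modulo subspaces -/

section Entropy

open scoped Classical in
/-- The mass under `π` of the equivalence class of `a`. -/
noncomputable def classMass {A : Type*} [Fintype A] (π : A → ℝ) (S : Setoid A) (a : A) : ℝ :=
  ∑ b, if S a b then π b else 0

/-- The Shannon entropy of the partition of `A` into the classes of `S`, for the weights `π`. -/
noncomputable def partEntropy {A : Type*} [Fintype A] (π : A → ℝ) (S : Setoid A) : ℝ :=
  - ∑ a, π a * Real.log (classMass π S a)

variable {A : Type*} [Fintype A] {π : A → ℝ}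

theorem le_classMass (hπ : ∀ a, 0 < π a) (S : Setoid A) (a : A) : π a ≤ classMass π S a := by
  classical
  have := single_le_sum (f := fun b => if S a b then π b else 0)
    (fun b _ => by split_ifs; exacts [(hπ b).le, le_rfl]) (mem_univ a)
  simpa [classMass, S.refl a] using this

theorem classMass_pos (hπ : ∀ a, 0 < π a) (S : Setoid A) (a : A) : 0 < classMass π S a :=
  (hπ a).trans_le (le_classMass hπ S a)

theorem classMass_le_sum (hπ : ∀ a, 0 < π a) (S : Setoid A) (a : A) :
    classMass π S a ≤ ∑ b, π b := by
  classical
  exact sum_le_sum fun b _ => by split_ifs; exacts [le_rfl, (hπ b).le]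

theorem classMass_eq_of_rel {S : Setoid A} {a b : A} (h : S a b) :
    classMass π S a = classMass π S b := by
  classical
  refine sum_congr rfl fun c _ => ?_
  have : S a c ↔ S b c := ⟨fun h' => S.trans (S.symm h) h', fun h' => S.trans h h'⟩
  simp only [this]

/-- Submodularity of Shannon entropy, in the form: the meet of two partitions and any common
coarsening have together at most the entropy of the two partitions. -/
theorem partEntropy_submodular (hπ : ∀ a, 0 < π a) {S₁ S₂ S₃ : Setoid A} (h₁ : S₁ ≤ S₃)
    (h₂ : S₂ ≤ S₃) :
    partEntropy π S₃ + partEntropy π (S₁ ⊓ S₂) ≤ partEntropy π S₁ + partEntropy π S₂ := by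
  classical
  set P₁ := classMass π S₁ with hP₁
  set P₂ := classMass π S₂ with hP₂
  set P₃ := classMass π S₃ with hP₃
  set P₀ := classMass π (S₁ ⊓ S₂) with hP₀
  have p₁ : ∀ a, 0 < P₁ a := classMass_pos hπ _
  have p₂ : ∀ a, 0 < P₂ a := classMass_pos hπ _
  have p₃ : ∀ a, 0 < P₃ a := classMass_pos hπ _
  have p₀ : ∀ a, 0 < P₀ a := classMass_pos hπ _
  have hinner : ∀ b c, ∑ a, (if S₁ a b ∧ S₂ a c then π a / (P₀ a * P₃ a) else 0) ≤
      (if S₃ b c then 1 / P₃ b else 0) := by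
    intro b c
    by_cases hex : ∃ a, S₁ a b ∧ S₂ a c
    · obtain ⟨a₀, hb, hc⟩ := hex
      have hbc : S₃ b c := S₃.trans (S₃.symm (h₁ hb)) (h₂ hc)
      rw [if_pos hbc]
      have hiff : ∀ a, (S₁ a b ∧ S₂ a c) ↔ (S₁ ⊓ S₂) a₀ a := by
        intro a
        change _ ↔ (S₁ a₀ a ∧ S₂ a₀ a)
        constructor
        · rintro ⟨h1, h2⟩
          exact ⟨S₁.trans hb (S₁.symm h1), S₂.trans hc (S₂.symm h2)⟩
        · rintro ⟨h1, h2⟩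
          exact ⟨S₁.trans (S₁.symm h1) hb, S₂.trans (S₂.symm h2) hc⟩
      have hterm : ∀ a, (if S₁ a b ∧ S₂ a c then π a / (P₀ a * P₃ a) else 0) =
          (if (S₁ ⊓ S₂) a₀ a then π a else 0) / (P₀ a₀ * P₃ b) := by
        intro a
        rw [if_congr (hiff a) rfl rfl]
        split_ifs with h
        · have e1 : P₀ a = P₀ a₀ := (classMass_eq_of_rel h).symm
          have e2 : P₃ a = P₃ b := classMass_eq_of_rel (h₁ ((hiff a).mpr h).1)
          rw [e1, e2]
        · simp
      rw [sum_congr rfl fun a _ => hterm a, ← sum_div]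
      have : ∑ a, (if (S₁ ⊓ S₂) a₀ a then π a else 0) = P₀ a₀ := rfl
      rw [this, div_mul_eq_div_div, div_self (p₀ a₀).ne']
    · push Not at hex
      rw [sum_eq_zero]
      · split_ifs
        · exact (one_div_pos.mpr (p₃ b)).le
        · exact le_rfl
      · intro a _
        rw [if_neg]
        exact fun h => hex a h.1 h.2
  have hratio : ∑ a, π a * (P₁ a * P₂ a / (P₀ a * P₃ a)) ≤ ∑ a, π a := by
    calc ∑ a, π a * (P₁ a * P₂ a / (P₀ a * P₃ a))
        = ∑ a, ∑ b, ∑ c, π b * π c *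
            (if S₁ a b ∧ S₂ a c then π a / (P₀ a * P₃ a) else 0) := by
          refine sum_congr rfl fun a _ => ?_
          have e1 : P₁ a = ∑ b, if S₁ a b then π b else 0 := rfl
          have e2 : P₂ a = ∑ b, if S₂ a b then π b else 0 := rfl
          rw [show π a * (P₁ a * P₂ a / (P₀ a * P₃ a)) =
            P₁ a * P₂ a * (π a / (P₀ a * P₃ a)) by ring, e1, e2, sum_mul_sum, sum_mul]
          refine sum_congr rfl fun b _ => ?_
          rw [sum_mul]
          refine sum_congr rfl fun c _ => ?_
          by_cases hb : S₁ a b <;> by_cases hc : S₂ a c <;> simp [hb, hc]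
      _ = ∑ b, ∑ c, π b * π c * ∑ a, (if S₁ a b ∧ S₂ a c then π a / (P₀ a * P₃ a) else 0) := by
          rw [sum_comm]
          refine sum_congr rfl fun b _ => ?_
          rw [sum_comm]
          exact sum_congr rfl fun c _ => (mul_sum _ _ _).symm
      _ ≤ ∑ b, ∑ c, π b * π c * (if S₃ b c then 1 / P₃ b else 0) := by
          gcongr with b _ c _
          · exact mul_nonneg (hπ b).le (hπ c).le
          · exact hinner b c
      _ = ∑ b, π b := by
          refine sum_congr rfl fun b _ => ?_
          have e3 : P₃ b = ∑ c, if S₃ b c then π c else 0 := rfl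
          have : ∀ c, π b * π c * (if S₃ b c then 1 / P₃ b else 0) =
              π b / P₃ b * (if S₃ b c then π c else 0) := by
            intro c
            split_ifs <;> ring
          rw [sum_congr rfl fun c _ => this c, ← mul_sum, ← e3, div_mul_cancel₀ _ (p₃ b).ne']
  have hlog : ∑ a, π a * (Real.log (P₁ a) + Real.log (P₂ a) - Real.log (P₀ a) - Real.log (P₃ a)) ≤
      ∑ a, π a * (P₁ a * P₂ a / (P₀ a * P₃ a) - 1) := by
    refine sum_le_sum fun a _ => mul_le_mul_of_nonneg_left ?_ (hπ a).le
    have := Real.log_le_sub_one_of_pos (show 0 < P₁ a * P₂ a / (P₀ a * P₃ a) from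
      div_pos (mul_pos (p₁ a) (p₂ a)) (mul_pos (p₀ a) (p₃ a)))
    rw [Real.log_div (mul_pos (p₁ a) (p₂ a)).ne' (mul_pos (p₀ a) (p₃ a)).ne',
      Real.log_mul (p₁ a).ne' (p₂ a).ne', Real.log_mul (p₀ a).ne' (p₃ a).ne'] at this
    linarith
  simp only [mul_sub, mul_add, sum_sub_distrib, sum_add_distrib, mul_one] at hlog
  unfold partEntropy
  linarith

end Entropy

/-- A submodular function on the subspaces of `W` that is invariant under a family of maps acting
irreducibly on `W` and agrees at `⊥` and `W` is minimal there: the least minimizer is unique,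
so it is invariant. -/
theorem le_of_submodular_of_irreducible {F V : Type*} [Field F] [AddCommGroup V] [Module F V]
    [Finite V] {W : Submodule F V} {φ : Submodule F V → ℝ} {c : ℝ}
    (hsub : ∀ U₁ U₂, φ (U₁ ⊔ U₂) + φ (U₁ ⊓ U₂) ≤ φ U₁ + φ U₂) {G : Set (V ≃ₗ[F] V)}
    (hGW : ∀ g ∈ G, W.map g.toLinearMap ≤ W) (hGφ : ∀ g ∈ G, ∀ U, φ (U.map g.toLinearMap) = φ U)
    (hirr : ∀ U ≤ W, (∀ g ∈ G, U ≤ U.map g.toLinearMap) → U = ⊥ ∨ U = W)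
    (h0 : φ ⊥ = c) (hW : φ W = c) {U : Submodule F V} (hU : U ≤ W) : c ≤ φ U := by
  have : Finite (Submodule F V) := Finite.of_injective (fun U => (U : Set V)) SetLike.coe_injective
  obtain ⟨U₀, hU₀, hmin⟩ := Set.exists_min_image {U : Submodule F V | U ≤ W} φ
    (Set.toFinite _) ⟨⊥, (bot_le : ⊥ ≤ W)⟩
  obtain ⟨U₁, hU₁, hmin₁⟩ := (Set.toFinite {U : Submodule F V | U ≤ W ∧ φ U = φ U₀}).exists_minimal
    ⟨U₀, hU₀, rfl⟩
  have hinv : ∀ g ∈ G, U₁ ≤ U₁.map g.toLinearMap := by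
    intro g hg
    have hgW : U₁.map g.toLinearMap ≤ W := (Submodule.map_mono hU₁.1).trans (hGW g hg)
    have h1 := hsub U₁ (U₁.map g.toLinearMap)
    have h2 := hmin (U₁ ⊔ U₁.map g.toLinearMap) (sup_le hU₁.1 hgW)
    have h3 := hmin (U₁ ⊓ U₁.map g.toLinearMap) (inf_le_left.trans hU₁.1)
    rw [hGφ g hg, hU₁.2] at h1
    have h4 : φ (U₁ ⊓ U₁.map g.toLinearMap) = φ U₀ := by linarith
    exact (hmin₁ ⟨inf_le_left.trans hU₁.1, h4⟩ inf_le_left).trans inf_le_right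
  have h5 := hmin U hU
  rcases hirr U₁ hU₁.1 hinv with h | h
  · rw [← h0, ← h, hU₁.2]; exact h5
  · rw [← hW, ← h, hU₁.2]; exact h5

section Cosets

variable {k M p : ℕ}

/-- The entries of a tuple, read modulo `p`. -/
def Col.toZMod (p : ℕ) (a : Col k M) : Fin k → ZMod p := fun i => ((a.1 i : ℕ) : ZMod p)

/-- The vectors with zero sum that vanish at `i`. -/
def zeroSumAt (p : ℕ) (i : Fin k) : Submodule (ZMod p) (Fin k → ZMod p) where
  carrier := {u | u i = 0 ∧ ∑ j, u j = 0}
  add_mem' := by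
    rintro u v ⟨h1, h2⟩ ⟨h3, h4⟩
    exact ⟨by simp [h1, h3], by simp [sum_add_distrib, h2, h4]⟩
  zero_mem' := by simp
  smul_mem' := by
    rintro c u ⟨h1, h2⟩
    exact ⟨by simp [h1], by simp [← mul_sum, h2]⟩

theorem mem_zeroSumAt {i : Fin k} {u : Fin k → ZMod p} :
    u ∈ zeroSumAt p i ↔ u i = 0 ∧ ∑ j, u j = 0 := Iff.rfl

theorem finrank_zeroSumAt [Fact p.Prime] (hk : 2 ≤ k) (i : Fin k) :
    Module.finrank (ZMod p) (zeroSumAt p i) = k - 2 := by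
  let L : (Fin k → ZMod p) →ₗ[ZMod p] (ZMod p × ZMod p) :=
    (LinearMap.proj i).prod (∑ j, LinearMap.proj j)
  have hL : ∀ u, L u = (u i, ∑ j, u j) := fun u => by simp [L]
  have hker : LinearMap.ker L = zeroSumAt p i := by
    ext u
    rw [LinearMap.mem_ker, hL, mem_zeroSumAt, Prod.mk_eq_zero]
  have hrange : LinearMap.range L = ⊤ := by
    rw [LinearMap.range_eq_top]
    rintro ⟨x, y⟩
    obtain ⟨j, hj⟩ : ∃ j, j ≠ i := by
      have : Nontrivial (Fin k) := Fin.nontrivial_iff_two_le.mpr hk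
      exact exists_ne i
    refine ⟨Pi.single i x + Pi.single j (y - x), ?_⟩
    rw [hL]
    simp [sum_add_distrib, Pi.single_eq_of_ne hj.symm]
  have := LinearMap.finrank_range_add_finrank_ker L
  rw [hker, hrange, finrank_top, Module.finrank_prod, Module.finrank_self,
    Module.finrank_fin_fun] at this
  omega

/-- Two tuples are equivalent when they agree modulo `p` up to an element of `U`. -/
def cosetRel (M : ℕ) (U : Submodule (ZMod p) (Fin k → ZMod p)) : Setoid (Col k M) :=
  Setoid.comap (Col.toZMod p) U.quotientRel

theorem cosetRel_iff {U : Submodule (ZMod p) (Fin k → ZMod p)} {a b : Col k M} :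
    cosetRel M U a b ↔ a.toZMod p - b.toZMod p ∈ U := by
  rw [cosetRel, Setoid.comap_rel, Submodule.quotientRel_def]

theorem cosetRel_inf (U₁ U₂ : Submodule (ZMod p) (Fin k → ZMod p)) :
    cosetRel M (U₁ ⊓ U₂) = cosetRel M U₁ ⊓ cosetRel M U₂ := by
  ext a b
  rw [Setoid.inf_iff_and, cosetRel_iff, cosetRel_iff, cosetRel_iff, Submodule.mem_inf]

theorem cosetRel_mono {U₁ U₂ : Submodule (ZMod p) (Fin k → ZMod p)} (h : U₁ ≤ U₂) :
    cosetRel M U₁ ≤ cosetRel M U₂ := by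
  intro a b hab
  exact cosetRel_iff.mpr (h (cosetRel_iff.mp hab))

theorem Col.toZMod_apply_inj (hp : M < p) {a b : Col k M} {i j : Fin k} :
    a.toZMod p i = b.toZMod p j ↔ a.1 i = b.1 j := by
  refine ⟨fun h => ?_, fun h => by simp only [Col.toZMod, h]⟩
  have := (ZMod.natCast_eq_natCast_iff' _ _ _).mp h
  have h1 := (a.1 i).2
  have h2 := (b.1 j).2
  rw [Nat.mod_eq_of_lt (by omega), Nat.mod_eq_of_lt (by omega)] at this
  exact Fin.ext this

theorem Col.sum_toZMod (a : Col k M) : ∑ i, a.toZMod p i = M := by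
  simp only [Col.toZMod, ← Nat.cast_sum, a.2]

theorem Col.toZMod_injective (hp : M < p) : Function.Injective (Col.toZMod (k := k) (M := M) p) := by
  intro a b h
  ext i
  exact congrArg Fin.val ((Col.toZMod_apply_inj hp).mp (congrFun h i))

theorem classMass_cosetRel_bot (hp : M < p) (π : Col k M → ℝ) (a : Col k M) :
    classMass π (cosetRel M (⊥ : Submodule (ZMod p) (Fin k → ZMod p))) a = π a := by
  classical
  have : ∀ b, cosetRel M (⊥ : Submodule (ZMod p) (Fin k → ZMod p)) a b ↔ a = b := by
    intro b
    rw [cosetRel_iff, Submodule.mem_bot, sub_eq_zero, (Col.toZMod_injective hp).eq_iff]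
  simp [classMass, this]

theorem classMass_cosetRel_zeroSumAt (hp : M < p) (π : Col k M → ℝ) (i : Fin k) (a : Col k M) :
    classMass π (cosetRel M (zeroSumAt p i)) a = ∑ b : Col k M, if b.1 i = a.1 i then π b else 0 := by
  classical
  have : ∀ b, cosetRel M (zeroSumAt p i) a b ↔ b.1 i = a.1 i := by
    intro b
    rw [cosetRel_iff, mem_zeroSumAt, Pi.sub_apply, sub_eq_zero, Col.toZMod_apply_inj hp]
    simp only [Pi.sub_apply, sum_sub_distrib, Col.sum_toZMod, sub_self, and_true]
    exact eq_comm
  simp only [classMass, this]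

/-- Permuting the entries of a tuple. -/
def Col.perm (τ : Equiv.Perm (Fin k)) : Col k M ≃ Col k M where
  toFun a := ⟨a.1 ∘ τ, (Equiv.sum_comp τ fun i => (a.1 i : ℕ)).trans a.2⟩
  invFun a := ⟨a.1 ∘ τ.symm, (Equiv.sum_comp τ.symm fun i => (a.1 i : ℕ)).trans a.2⟩
  left_inv a := by ext i; simp
  right_inv a := by ext i; simp

theorem Col.perm_apply (τ : Equiv.Perm (Fin k)) (a : Col k M) (i : Fin k) :
    (Col.perm τ a).1 i = a.1 (τ i) := rfl

theorem partEntropy_map_perm {π : Col k M → ℝ} (hsym : ∀ τ a, π (Col.perm τ a) = π a)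
    (τ : Equiv.Perm (Fin k)) (U : Submodule (ZMod p) (Fin k → ZMod p)) :
    partEntropy π (cosetRel M (U.map (LinearEquiv.funCongrLeft (ZMod p) (ZMod p) τ).toLinearMap)) =
      partEntropy π (cosetRel M U) := by
  classical
  have hrel : ∀ a b : Col k M, cosetRel M
      (U.map (LinearEquiv.funCongrLeft (ZMod p) (ZMod p) τ).toLinearMap)
        (Col.perm τ a) (Col.perm τ b) ↔ cosetRel M U a b := by
    intro a b
    rw [cosetRel_iff, cosetRel_iff]
    have : (Col.perm τ a).toZMod p - (Col.perm τ b).toZMod p =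
        LinearEquiv.funCongrLeft (ZMod p) (ZMod p) τ (a.toZMod p - b.toZMod p) := by
      ext i; rfl
    rw [this]
    constructor
    · rintro ⟨v, hv, hv'⟩
      rwa [← (LinearEquiv.funCongrLeft (ZMod p) (ZMod p) τ).injective hv']
    · exact fun h => ⟨_, h, rfl⟩
  unfold partEntropy
  rw [← Equiv.sum_comp (Col.perm τ)]
  congr 1
  refine sum_congr rfl fun a _ => ?_
  rw [hsym]
  congr 2
  unfold classMass
  rw [← Equiv.sum_comp (Col.perm τ)]
  simp only [hrel, hsym]

/-- The permutations fixing `i` act irreducibly on `zeroSumAt p i` when `k < p`, so that `k - 1 ≠ 0`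
modulo `p`. -/
theorem eq_bot_or_eq_zeroSumAt [Fact p.Prime] (hp : k < p) {i : Fin k}
    {U : Submodule (ZMod p) (Fin k → ZMod p)} (hU : U ≤ zeroSumAt p i)
    (hinv : ∀ j l, j ≠ i → l ≠ i → ∀ u ∈ U, u ∘ Equiv.swap j l ∈ U) :
    U = ⊥ ∨ U = zeroSumAt p i := by
  refine or_iff_not_imp_left.mpr fun hne => le_antisymm hU fun w hw => ?_
  obtain ⟨u, huU, hu0⟩ := (Submodule.ne_bot_iff U).mp hne
  have hui := hU huU
  rw [mem_zeroSumAt] at hui hw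
  obtain ⟨j, l, hj, hl, hjl⟩ : ∃ j l, j ≠ i ∧ l ≠ i ∧ u j ≠ u l := by
    by_contra! hcon
    apply hu0
    ext j
    by_cases hj : j = i
    · rw [hj]; exact hui.1
    · have h1 : ∑ l, u l = ∑ l ∈ univ.erase i, u j := by
        rw [← add_sum_erase _ _ (mem_univ i), hui.1, zero_add]
        exact sum_congr rfl fun l hl => hcon l j (ne_of_mem_erase hl) hj
      rw [hui.2, sum_const, card_erase_of_mem (mem_univ i), card_univ, Fintype.card_fin,
        nsmul_eq_mul] at h1
      have hk1 : 1 < k := by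
        by_contra hk
        exact hj (Fin.ext (by have := i.2; have := j.2; omega))
      have h2 : ((k - 1 : ℕ) : ZMod p) ≠ 0 := by
        rw [Ne, ZMod.natCast_eq_zero_iff]
        intro hdvd
        have := Nat.le_of_dvd (by omega) hdvd
        omega
      exact (mul_eq_zero.mp h1.symm).resolve_left h2
  have hjlne : j ≠ l := fun h => hjl (by rw [h])
  have hbase : Pi.single j 1 - Pi.single l 1 ∈ U := by
    have h1 := U.smul_mem (u j - u l)⁻¹ (U.sub_mem huU (hinv j l hj hl u huU))
    convert h1 using 1
    have hne' : u j - u l ≠ 0 := sub_ne_zero.mpr hjl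
    ext m
    simp only [Pi.sub_apply, Pi.smul_apply, Function.comp_apply, smul_eq_mul]
    by_cases hmj : m = j
    · subst hmj
      rw [Equiv.swap_apply_left, Pi.single_eq_same, Pi.single_eq_of_ne hjlne]
      field_simp; ring
    · by_cases hml : m = l
      · subst hml
        rw [Equiv.swap_apply_right, Pi.single_eq_same, Pi.single_eq_of_ne hmj]
        field_simp; ring
      · rw [Equiv.swap_apply_of_ne_of_ne hmj hml, Pi.single_eq_of_ne hmj, Pi.single_eq_of_ne hml]
        ring
  have hall : ∀ m, m ≠ i → Pi.single j 1 - Pi.single m 1 ∈ U := by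
    intro m hm
    by_cases hmj : m = j
    · rw [hmj, sub_self]; exact U.zero_mem
    · convert hinv l m hl hm _ hbase using 1
      ext x
      simp only [Pi.sub_apply, Function.comp_apply, Pi.single_apply]
      by_cases hxl : x = l
      · subst hxl
        rw [Equiv.swap_apply_left]
        by_cases hxm : x = m
        · subst hxm; simp [hjlne.symm]
        · simp [hmj, hxm, hjlne.symm, Ne.symm hxm]
      · by_cases hxm : x = m
        · subst hxm
          rw [Equiv.swap_apply_right]
          simp [hmj, hjlne.symm]
        · rw [Equiv.swap_apply_of_ne_of_ne hxl hxm]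
          simp [hxl, hxm]
  have hwexp : w = ∑ m, (- w m) • (Pi.single j 1 - Pi.single m 1 : Fin k → ZMod p) := by
    ext x
    simp only [Finset.sum_apply, Pi.smul_apply, Pi.sub_apply, smul_eq_mul, mul_sub,
      sum_sub_distrib, ← sum_mul, sum_neg_distrib, hw.2]
    simp [Pi.single_apply]
  rw [hwexp]
  refine U.sum_mem fun m _ => ?_
  by_cases hm : m = i
  · rw [hm, hw.1]; simp
  · exact U.smul_mem _ (hall m hm)

/-- The entropy lost by reading a symmetric random tuple modulo `U ≤ zeroSumAt p i` is at most
`dim U / (k - 2)` times the entropy lost by reading only its `i`-th entry. -/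
theorem entropy_deficit_le [Fact p.Prime] (hk : 3 ≤ k) (hkp : k < p) (hMp : M < p)
    {π : Col k M → ℝ} (hπ : ∀ a, 0 < π a) (hsym : ∀ τ a, π (Col.perm τ a) = π a) (i : Fin k)
    {U : Submodule (ZMod p) (Fin k → ZMod p)} (hU : U ≤ zeroSumAt p i) :
    ∑ a, π a * (Real.log (classMass π (cosetRel M U) a) - Real.log (π a)) ≤
      Module.finrank (ZMod p) U * ((∑ a, π a *
        (Real.log (∑ b : Col k M, if b.1 i = a.1 i then π b else 0) - Real.log (π a))) / (k - 2)) := by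
  set δ := (∑ a, π a *
        (Real.log (∑ b : Col k M, if b.1 i = a.1 i then π b else 0) - Real.log (π a))) / ((k : ℝ) - 2)
    with hδ
  have hk2 : (0 : ℝ) < (k : ℝ) - 2 := by
    have : (3 : ℝ) ≤ k := by exact_mod_cast hk
    linarith
  have hbot : partEntropy π (cosetRel M (⊥ : Submodule (ZMod p) (Fin k → ZMod p))) =
      - ∑ a, π a * Real.log (π a) := by
    simp only [partEntropy, classMass_cosetRel_bot hMp]
  have hW : partEntropy π (cosetRel M (zeroSumAt p i)) + δ * (k - 2) =
      - ∑ a, π a * Real.log (π a) := by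
    rw [hδ, div_mul_cancel₀ _ hk2.ne']
    simp only [partEntropy, classMass_cosetRel_zeroSumAt hMp, mul_sub, sum_sub_distrib]
    ring
  have key := le_of_submodular_of_irreducible (W := zeroSumAt p i)
    (φ := fun U => partEntropy π (cosetRel M U) + δ * Module.finrank (ZMod p) U)
    (c := - ∑ a, π a * Real.log (π a))
    (G := {g | ∃ j l, j ≠ i ∧ l ≠ i ∧
      g = LinearEquiv.funCongrLeft (ZMod p) (ZMod p) (Equiv.swap j l)})
    (by
      intro U₁ U₂
      have h1 := partEntropy_submodular hπ (cosetRel_mono (M := M) (le_sup_left : U₁ ≤ U₁ ⊔ U₂))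
        (cosetRel_mono (le_sup_right : U₂ ≤ U₁ ⊔ U₂))
      rw [← cosetRel_inf] at h1
      have h2 : (Module.finrank (ZMod p) ↑(U₁ ⊔ U₂) : ℝ) + Module.finrank (ZMod p) ↑(U₁ ⊓ U₂) =
          Module.finrank (ZMod p) U₁ + Module.finrank (ZMod p) U₂ := by
        exact_mod_cast Submodule.finrank_sup_add_finrank_inf_eq U₁ U₂
      have h3 := congrArg (fun x => δ * x) h2
      simp only [mul_add] at h3
      linarith)
    (by
      rintro _ ⟨j, l, hj, hl, rfl⟩ _ ⟨u, hu, rfl⟩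
      have hu' := mem_zeroSumAt.mp hu
      refine mem_zeroSumAt.mpr ⟨?_, ?_⟩
      · show u (Equiv.swap j l i) = 0
        rw [Equiv.swap_apply_of_ne_of_ne hj.symm hl.symm]; exact hu'.1
      · rw [← hu'.2]
        exact Equiv.sum_comp (Equiv.swap j l) u)
    (by
      rintro _ ⟨j, l, hj, hl, rfl⟩ U
      rw [partEntropy_map_perm hsym]
      congr 3
      exact LinearEquiv.finrank_map_eq _ U)
    (by
      intro U hU hinv
      refine eq_bot_or_eq_zeroSumAt hkp hU fun j l hj hl u hu => ?_
      obtain ⟨v, hv, rfl⟩ := hinv _ ⟨j, l, hj, hl, rfl⟩ hu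
      have : (LinearEquiv.funCongrLeft (ZMod p) (ZMod p) (Equiv.swap j l)).toLinearMap v ∘
          Equiv.swap j l = v := by
        ext x
        simp [LinearEquiv.funCongrLeft_apply, LinearMap.funLeft_apply]
      rw [this]
      exact hv)
    (by simp only [hbot, finrank_bot, Nat.cast_zero, mul_zero, add_zero])
    (by
      rw [finrank_zeroSumAt (by omega), Nat.cast_sub (by omega)]
      exact_mod_cast hW) hU
  simp only [partEntropy] at key
  simp only [mul_sub, sum_sub_distrib]
  linarith

end Cosets

/-! ### Behrend's construction -/

/-- The base-`D` number with `N` digits `a` is less than `D ^ N`. -/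
theorem behrend_map_lt {N D : ℕ} (a : Fin N → ℕ) (ha : ∀ i, a i < D) : Behrend.map D a < D ^ N := by
  induction N with
  | zero => simp
  | succ N ih =>
    rw [Behrend.map_succ', pow_succ]
    have h1 := ih (a ∘ Fin.succ) fun i => ha _
    have h2 := ha 0
    nlinarith

/-- A sphere contains no nontrivial solution of `∑_{i ≠ i₀} x_i = (k - 1) x_{i₀}`, because the
squared distances from `x_{i₀}` add up to zero. -/
theorem eq_of_sum_eq_on_sphere {k N : ℕ} {r : ℤ} (x : Fin k → Fin N → ℤ) (i₀ : Fin k)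
    (hx : ∀ i, ∑ c, x i c ^ 2 = r)
    (hsum : ∀ c, ∑ i ∈ univ.erase i₀, x i c = ((univ.erase i₀).card : ℤ) * x i₀ c) (i : Fin k) :
    x i = x i₀ := by
  have key : ∑ i ∈ univ.erase i₀, ∑ c, (x i c - x i₀ c) ^ 2 = 0 := by
    have h1 : ∀ i, ∑ c, (x i c - x i₀ c) ^ 2 = 2 * r - 2 * ∑ c, x i c * x i₀ c := by
      intro i
      rw [two_mul r]
      nth_rewrite 1 [← hx i]
      rw [← hx i₀, mul_sum, ← sum_add_distrib, ← sum_sub_distrib]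
      exact sum_congr rfl fun c _ => by ring
    rw [sum_congr rfl fun i _ => h1 i, sum_sub_distrib, ← mul_sum (univ.erase i₀)
      (fun i => ∑ c, x i c * x i₀ c) 2, sum_comm]
    have h2 : ∀ c, ∑ i ∈ univ.erase i₀, x i c * x i₀ c =
        ((univ.erase i₀).card : ℤ) * x i₀ c ^ 2 := by
      intro c
      rw [← sum_mul, hsum]; ring
    rw [sum_congr rfl fun c _ => h2 c, ← mul_sum univ (fun c => x i₀ c ^ 2), hx, sum_const,
      nsmul_eq_mul]
    ring
  by_cases hi : i = i₀
  · rw [hi]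
  · have h3 := (sum_eq_zero_iff_of_nonneg fun i _ => sum_nonneg fun c _ => sq_nonneg _).mp key i
      (mem_erase.mpr ⟨hi, mem_univ _⟩)
    have h4 := (sum_eq_zero_iff_of_nonneg fun c _ => sq_nonneg _).mp h3
    ext c
    have := h4 c (mem_univ c)
    rw [sq_eq_zero_iff, sub_eq_zero] at this
    exact this

/-- Behrend's construction for the equation `∑_{i ≠ i₀} y_i = (k - 1) y_{i₀}` modulo `p`. -/
theorem exists_diagonal_family {k N d p : ℕ} (hk : 2 ≤ k)
    (hp : k * (k * d) ^ N < p) :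
    ∃ (L : ℕ) (β : Fin L → Fin k → ZMod p), ((d ^ N : ℕ) / (N * d ^ 2 : ℕ) : ℝ) ≤ L ∧
      ∀ j : Fin k → Fin L, ∑ i, β (j i) i = 0 ↔ ∀ i i', j i = j i' := by
  obtain ⟨r, hr⟩ := Behrend.exists_large_sphere N d
  set S := Behrend.sphere N d r with hS
  set i₀ : Fin k := ⟨0, by omega⟩ with hi₀
  have hcard : (univ.erase i₀).card = k - 1 := by
    rw [card_erase_of_mem (mem_univ _), card_univ, Fintype.card_fin]
  let X : Fin S.card → Fin N → ℕ := fun j => (S.equivFin.symm j).1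
  have hXmem : ∀ j, X j ∈ S := fun j => (S.equivFin.symm j).2
  have hXinj : ∀ j j', X j = X j' → j = j' := fun j j' h =>
    S.equivFin.symm.injective (Subtype.ext h)
  have hXd : ∀ j c, X j c < d := fun j c =>
    Behrend.mem_box.mp (Behrend.sphere_subset_box (hXmem j)) c
  have hXr : ∀ j, ∑ c, X j c ^ 2 = r := fun j => (mem_filter.mp (hXmem j)).2
  have hdk : d ≤ k * d := Nat.le_mul_of_pos_left _ (by omega)
  have hmlt : ∀ j, Behrend.map (k * d) (X j) < (k * d) ^ N := fun j =>
    behrend_map_lt _ fun c => (hXd j c).trans_le hdk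
  let β : Fin S.card → Fin k → ZMod p := fun j i =>
    if i = i₀ then - (((k - 1) * Behrend.map (k * d) (X j) : ℕ) : ZMod p)
    else ((Behrend.map (k * d) (X j) : ℕ) : ZMod p)
  have hβsum : ∀ j : Fin k → Fin S.card, ∑ i, β (j i) i =
      ((∑ i ∈ univ.erase i₀, Behrend.map (k * d) (X (j i)) : ℕ) : ZMod p) -
        (((k - 1) * Behrend.map (k * d) (X (j i₀)) : ℕ) : ZMod p) := by
    intro j
    rw [← add_sum_erase _ _ (mem_univ i₀), Nat.cast_sum]
    have h1 : ∑ i ∈ univ.erase i₀, β (j i) i =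
        ∑ i ∈ univ.erase i₀, ((Behrend.map (k * d) (X (j i)) : ℕ) : ZMod p) :=
      sum_congr rfl fun i hi => if_neg (ne_of_mem_erase hi)
    have h2 : β (j i₀) i₀ = - (((k - 1) * Behrend.map (k * d) (X (j i₀)) : ℕ) : ZMod p) :=
      if_pos rfl
    rw [h1, h2]
    ring
  refine ⟨S.card, β, hr, fun j => ?_⟩
  rw [hβsum, sub_eq_zero]
  constructor
  · intro h
    rw [ZMod.natCast_eq_natCast_iff', Nat.mod_eq_of_lt, Nat.mod_eq_of_lt] at h
    · rw [← map_sum, ← smul_eq_mul (a := k - 1), ← map_nsmul] at h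
      have h1 := Behrend.map_injOn (d := k * d) (by
        intro c
        rw [Finset.sum_apply]
        calc ∑ i ∈ univ.erase i₀, X (j i) c ≤ ∑ i ∈ univ.erase i₀, d :=
              sum_le_sum fun i _ => (hXd _ _).le
          _ = (k - 1) * d := by rw [sum_const, hcard, smul_eq_mul]
          _ < k * d := by
              have := hXd (j i₀) c
              exact Nat.mul_lt_mul_of_pos_right (by omega) (by omega)) (by
        intro c
        have h0 := hXd (j i₀) c
        show (k - 1) * X (j i₀) c < k * d
        calc (k - 1) * X (j i₀) c ≤ (k - 1) * d := Nat.mul_le_mul_left _ h0.le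
          _ < k * d := Nat.mul_lt_mul_of_pos_right (by omega) (by omega)) h
      have h2 := eq_of_sum_eq_on_sphere (fun i c => (X (j i) c : ℤ)) i₀ (r := r)
        (fun i => by exact_mod_cast hXr (j i)) (fun c => by
          have := congrFun h1 c
          rw [Finset.sum_apply] at this
          rw [hcard]
          exact_mod_cast this)
      have h3 : ∀ i, j i = j i₀ := by
        intro i
        apply hXinj
        ext c
        exact_mod_cast congrFun (h2 i) c
      intro i i'
      rw [h3 i, h3 i']
    · calc (k - 1) * Behrend.map (k * d) (X (j i₀)) ≤ k * (k * d) ^ N :=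
            Nat.mul_le_mul (by omega) (hmlt _).le
        _ < p := hp
    · calc ∑ i ∈ univ.erase i₀, Behrend.map (k * d) (X (j i))
          ≤ ∑ i ∈ univ.erase i₀, (k * d) ^ N := sum_le_sum fun i _ => (hmlt _).le
        _ = (k - 1) * (k * d) ^ N := by rw [sum_const, hcard, smul_eq_mul]
        _ ≤ k * (k * d) ^ N := Nat.mul_le_mul_right _ (by omega)
        _ < p := hp
  · intro h
    congr 1
    rw [sum_congr rfl fun i _ => by rw [h i i₀], sum_const, hcard, smul_eq_mul]

/-! ### Type classes -/

section TypeClasses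

variable {A : Type*} [Fintype A] [DecidableEq A]

/-- The words of length `n` in which every letter `a` occurs exactly `σ a` times. -/
def typeClass (n : ℕ) (σ : A → ℕ) : Finset (Fin n → A) :=
  {t | ∀ a, #{l | t l = a} = σ a}

theorem mem_typeClass {n : ℕ} {σ : A → ℕ} {t : Fin n → A} :
    t ∈ typeClass n σ ↔ ∀ a, #{l | t l = a} = σ a := by
  simp [typeClass]

theorem sum_comp_of_mem_typeClass {R : Type*} [CommRing R] {n : ℕ} {σ : A → ℕ} {t : Fin n → A}
    (ht : t ∈ typeClass n σ) (g : A → R) : ∑ l, g (t l) = ∑ a, (σ a : R) * g a := by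
  rw [← sum_fiberwise univ t]
  refine sum_congr rfl fun a _ => ?_
  rw [sum_congr rfl fun l hl => by rw [(mem_filter.mp hl).2], sum_const,
    mem_typeClass.mp ht, nsmul_eq_mul]

theorem typeClass_nonempty {n : ℕ} {σ : A → ℕ} (hσ : ∑ a, σ a = n) : (typeClass n σ).Nonempty := by
  have hc : Fintype.card (Fin n) = Fintype.card (Σ a, Fin (σ a)) := by simp [hσ]
  let e := Fintype.equivOfCardEq hc
  refine ⟨fun l => (e l).1, mem_typeClass.mpr fun a => ?_⟩
  rw [← Fintype.card_subtype]
  have : {l // (e l).1 = a} ≃ Fin (σ a) :=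
    (e.subtypeEquiv (p := fun l => (e l).1 = a) (q := fun x => x.1 = a) fun _ => Iff.rfl).trans
      (Equiv.sigmaSubtype a)
  rw [Fintype.card_congr this, Fintype.card_fin]

/-- Orbit counting for the action of the permutations of positions on words. -/
theorem factorial_le_card_typeClass {n : ℕ} {σ : A → ℕ} (hσ : ∑ a, σ a = n) :
    n.factorial ≤ (∏ a, (σ a).factorial) * #(typeClass n σ) := by
  obtain ⟨t₀, ht₀⟩ := typeClass_nonempty hσ
  have hstab := DomMulAct.stabilizer_card t₀
  have hfac : ∏ a, (Fintype.card {l // t₀ l = a}).factorial = ∏ a, (σ a).factorial :=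
    prod_congr rfl fun a _ => by rw [Fintype.card_subtype, mem_typeClass.mp ht₀]
  have := card_le_mul_card_image_of_maps_to (s := (univ : Finset (Equiv.Perm (Fin n))))
    (t := typeClass n σ) (f := fun g : Equiv.Perm (Fin n) => t₀ ∘ g) (by
      intro g _
      rw [mem_typeClass]
      intro a
      rw [← mem_typeClass.mp ht₀ a]
      refine card_bij (fun l _ => g l) ?_ ?_ ?_
      · intro l hl; simpa using hl
      · intro l _ l' _ h; exact g.injective h
      · intro l hl; exact ⟨g.symm l, by simpa using hl, by simp⟩) (∏ a, (σ a).factorial) (by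
      intro t _
      rcases (univ.filter fun g : Equiv.Perm (Fin n) => t₀ ∘ g = t).eq_empty_or_nonempty with h | h
      · rw [h]; exact Nat.zero_le _
      · obtain ⟨g₀, hg₀⟩ := h
        rw [mem_filter] at hg₀
        rw [← hfac, ← hstab, Fintype.card_subtype]
        refine card_le_card_of_injOn (fun g => g * g₀⁻¹) ?_ fun g _ g' _ h => mul_right_cancel h
        intro g hg
        have hg' : t₀ ∘ g = t := (mem_filter.mp hg).2
        refine mem_filter.mpr ⟨mem_univ _, ?_⟩
        rw [Equiv.Perm.coe_mul, ← Function.comp_assoc, hg', ← hg₀.2, Function.comp_assoc,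
          ← Equiv.Perm.coe_mul, mul_inv_cancel, Equiv.Perm.coe_one, Function.comp_id])
  rwa [card_univ, Fintype.card_perm, Fintype.card_fin] at this

theorem log_factorial_ge (n : ℕ) : (n : ℝ) * Real.log n - n ≤ Real.log n.factorial := by
  rcases Nat.eq_zero_or_pos n with rfl | hn
  · simp
  · have h := Real.pow_div_factorial_le_exp n (Nat.cast_nonneg n) n
    have h0 : (0 : ℝ) < n := by exact_mod_cast hn
    have h1 : (0 : ℝ) < n.factorial := by exact_mod_cast n.factorial_pos
    have h2 := Real.log_le_log (by positivity) h
    rw [Real.log_exp, Real.log_div (by positivity) h1.ne', Real.log_pow] at h2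
    linarith

/-- The upper Stirling bound `m! ≤ e m (m / e) ^ m` at `m = n + 1`. -/
theorem log_factorial_le (n : ℕ) :
    Real.log (n + 1).factorial ≤
      ((n : ℝ) + 1) * Real.log (n + 1) - (n + 1) + Real.log (n + 1) + 1 := by
  induction n with
  | zero => simp
  | succ n ih =>
    have h1 : (0 : ℝ) < (n : ℝ) + 1 := by positivity
    have h2 : (0 : ℝ) < (n : ℝ) + 2 := by positivity
    rw [Nat.factorial_succ, Nat.cast_mul, Real.log_mul (by positivity)
      (by exact_mod_cast (Nat.factorial_pos _).ne')]
    push_cast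
    rw [show (n : ℝ) + 1 + 1 = n + 2 by ring]
    have h3 := Real.log_le_sub_one_of_pos (div_pos h1 h2)
    rw [Real.log_div h1.ne' h2.ne'] at h3
    have h4 : ((n : ℝ) + 2) * (Real.log (n + 1) - Real.log (n + 2)) ≤ -1 := by
      calc ((n : ℝ) + 2) * (Real.log (n + 1) - Real.log (n + 2))
          ≤ (n + 2) * ((n + 1) / (n + 2) - 1) := mul_le_mul_of_nonneg_left h3 h2.le
        _ = -1 := by field_simp; ring
    linarith

/-- A type class has exponentially the size predicted by the entropy, up to a polynomial factor. -/
theorem log_card_typeClass_ge {n : ℕ} (hn : 1 ≤ n) {σ : A → ℕ} (hσ : ∑ a, σ a = n)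
    {π : A → ℝ} (hπ : ∀ a, 0 < π a) {c : ℝ} (hc : ∀ a, |(σ a : ℝ) - n * π a| ≤ c) :
    n * (-∑ a, π a * Real.log (π a)) - Fintype.card A * Real.log n -
      (Fintype.card A + c * ∑ a, (1 / π a + |Real.log (π a)|)) ≤
      Real.log #(typeClass n σ) := by
  have hn0 : (0 : ℝ) < n := by exact_mod_cast hn
  have hn1 : (1 : ℝ) ≤ n := by exact_mod_cast hn
  have hO : 0 < #(typeClass n σ) := card_pos.mpr (typeClass_nonempty hσ)
  have hσn : ∀ a, σ a ≤ n := fun a => hσ ▸ single_le_sum (fun _ _ => Nat.zero_le _) (mem_univ a)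
  have hfac : ∀ a, ((σ a).factorial : ℝ) ≠ 0 := fun a => by exact_mod_cast (Nat.factorial_pos _).ne'
  have h1 : (n.factorial : ℝ) ≤ (∏ a, ((σ a).factorial : ℝ)) * #(typeClass n σ) := by
    exact_mod_cast factorial_le_card_typeClass hσ
  have h2 := Real.log_le_log (by exact_mod_cast n.factorial_pos) h1
  rw [Real.log_mul (prod_ne_zero_iff.mpr fun a _ => hfac a) (by exact_mod_cast hO.ne'),
    Real.log_prod fun a _ => hfac a] at h2
  have h3 := log_factorial_ge n
  have h4 : ∀ a, Real.log (σ a).factorial ≤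
      σ a * Real.log (n * π a) - σ a + (Real.log n + 1) + c * (1 / π a) := by
    intro a
    have hcn := (abs_le.mp (hc a)).2
    have hc0 : 0 ≤ c := (abs_nonneg _).trans (hc a)
    have hlogn : 0 ≤ Real.log n := Real.log_nonneg hn1
    have hx : 0 ≤ c * (1 / π a) := mul_nonneg hc0 (by have := hπ a; positivity)
    rcases Nat.eq_zero_or_pos (σ a) with h0 | h0
    · rw [h0]; simp; simp at hx; linarith
    · obtain ⟨s, hs⟩ : ∃ s, σ a = s + 1 := ⟨σ a - 1, by omega⟩
      have h5 := log_factorial_le s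
      rw [← hs, show (s : ℝ) + 1 = σ a by rw [hs]; push_cast; ring] at h5
      have hσ0 : (0 : ℝ) < σ a := by exact_mod_cast h0
      have h6 : Real.log (σ a) ≤ Real.log n :=
        Real.log_le_log hσ0 (by exact_mod_cast hσn a)
      have hnπ : 0 < n * π a := mul_pos hn0 (hπ a)
      have h7 := Real.log_le_sub_one_of_pos (div_pos hσ0 hnπ)
      rw [Real.log_div hσ0.ne' hnπ.ne'] at h7
      have h8 : (σ a : ℝ) * (σ a / (n * π a) - 1) ≤ c * (1 / π a) := by
        have e : (σ a : ℝ) * (σ a / (n * π a) - 1) = (σ a / n) * ((σ a - n * π a) / π a) := by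
          have := (hπ a).ne'
          field_simp
        rw [e]
        have h9 : (σ a : ℝ) / n ≤ 1 := (div_le_one hn0).mpr (by exact_mod_cast hσn a)
        have h10 : (σ a - n * π a) / π a ≤ c * (1 / π a) := by
          rw [mul_one_div]
          exact div_le_div_of_nonneg_right hcn (hπ a).le
        calc (σ a / n) * ((σ a - n * π a) / π a) ≤ (σ a / n) * (c * (1 / π a)) :=
              mul_le_mul_of_nonneg_left h10 (by positivity)
          _ ≤ 1 * (c * (1 / π a)) := mul_le_mul_of_nonneg_right h9 hx
          _ = _ := one_mul _
      have h11 := mul_le_mul_of_nonneg_left h7 hσ0.le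
      linarith
  have h5 : ∀ a, (σ a : ℝ) * Real.log (n * π a) ≤
      σ a * Real.log n + n * (π a * Real.log (π a)) + c * |Real.log (π a)| := by
    intro a
    rw [Real.log_mul hn0.ne' (hπ a).ne', mul_add]
    have : ((σ a : ℝ) - n * π a) * Real.log (π a) ≤ c * |Real.log (π a)| :=
      (le_abs_self _).trans (by
        rw [abs_mul]; exact mul_le_mul_of_nonneg_right (hc a) (abs_nonneg _))
    linarith
  have h6 : ∑ a, Real.log (σ a).factorial ≤ ∑ a, ((σ a : ℝ) * Real.log n +
      n * (π a * Real.log (π a)) - σ a + (Real.log n + 1) +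
        c * (1 / π a + |Real.log (π a)|)) :=
    sum_le_sum fun a _ => by linarith [h4 a, h5 a]
  have hσR : ∑ a, (σ a : ℝ) = n := by exact_mod_cast hσ
  simp only [sum_add_distrib, sum_sub_distrib, ← sum_mul, ← mul_sum, hσR, sum_const, card_univ,
    nsmul_eq_mul, mul_one] at h6 ⊢
  linarith

/-- The words of the same weight as `t` that agree with `t` up to the equivalence `S` in every
position: their number is bounded through the probability of the class of `t`. -/
theorem card_equiv_words_le {n : ℕ} {σ : A → ℕ} {π : A → ℝ} (hπ : ∀ a, 0 < π a)
    (hπ1 : ∑ a, π a = 1) {c : ℝ} (hc : ∀ a, |(σ a : ℝ) - n * π a| ≤ c) {t : Fin n → A}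
    (ht : t ∈ typeClass n σ) (S : Setoid A) (T : Finset (Fin n → A))
    (hT : ∀ t' ∈ T, ∏ l, π (t' l) = ∏ l, π (t l) ∧ ∀ l, S (t l) (t' l)) :
    (#T : ℝ) ≤ Real.exp (n * (∑ a, π a * (Real.log (classMass π S a) - Real.log (π a))) +
      c * ∑ a, |Real.log (π a)|) := by
  classical
  have hpos : 0 < ∏ l, π (t l) := prod_pos fun l _ => hπ _
  have h1 : #T * ∏ l, π (t l) ≤ ∏ l, classMass π S (t l) := by
    have e : ∏ l, classMass π S (t l) =
        ∑ s ∈ Fintype.piFinset (fun _ : Fin n => (univ : Finset A)),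
          ∏ l, (if S (t l) (s l) then π (s l) else 0) := by
      unfold classMass
      rw [prod_univ_sum]
    rw [e, ← nsmul_eq_mul, ← sum_const]
    calc ∑ _t' ∈ T, ∏ l, π (t l)
        = ∑ t' ∈ T, ∏ l, (if S (t l) (t' l) then π (t' l) else 0) := by
          refine sum_congr rfl fun t' ht' => ?_
          rw [← (hT t' ht').1]
          exact prod_congr rfl fun l _ => by rw [if_pos ((hT t' ht').2 l)]
      _ ≤ _ := by
          refine sum_le_sum_of_subset_of_nonneg (fun t' _ => by simp) fun s _ _ => ?_
          exact prod_nonneg fun l _ => by split_ifs; exacts [(hπ _).le, le_rfl]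
  have h2 : ∏ l, classMass π S (t l) = Real.exp (∑ l, Real.log (classMass π S (t l))) := by
    rw [Real.exp_sum]
    exact prod_congr rfl fun l _ => (Real.exp_log (classMass_pos hπ S _)).symm
  have h3 : ∏ l, π (t l) = Real.exp (∑ l, Real.log (π (t l))) := by
    rw [Real.exp_sum]
    exact prod_congr rfl fun l _ => (Real.exp_log (hπ _)).symm
  rw [← le_div_iff₀ hpos, h2, h3, ← Real.exp_sub] at h1
  refine h1.trans (Real.exp_le_exp.mpr ?_)
  rw [sum_comp_of_mem_typeClass ht (fun a => Real.log (classMass π S a)),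
    sum_comp_of_mem_typeClass ht (fun a => Real.log (π a)), ← sum_sub_distrib, mul_sum, mul_sum,
    ← sum_add_distrib]
  refine sum_le_sum fun a _ => ?_
  have h4 : Real.log (π a) ≤ Real.log (classMass π S a) :=
    Real.log_le_log (hπ a) (le_classMass hπ S a)
  have h5 : Real.log (classMass π S a) ≤ 0 :=
    Real.log_nonpos (classMass_pos hπ S a).le (hπ1 ▸ classMass_le_sum hπ S a)
  have h6 : ((σ a : ℝ) - n * π a) * (Real.log (classMass π S a) - Real.log (π a)) ≤
      c * |Real.log (π a)| := by
    refine (le_abs_self _).trans ?_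
    rw [abs_mul]
    refine mul_le_mul (hc a) ?_ (abs_nonneg _) ((abs_nonneg _).trans (hc a))
    rw [abs_of_nonneg (sub_nonneg.mpr h4), abs_of_nonpos (h4.trans h5)]
    linarith
  linarith

end TypeClasses

section SymmetricTypes

variable {k M : ℕ}

theorem Col.single_injective (hM : 1 ≤ M) : Function.Injective (Col.single (k := k) (M := M)) := by
  intro i j h
  by_contra hij
  have h1 := congrFun (congrArg Subtype.val h) i
  simp only [Col.single, Pi.single_eq_same, Pi.single_eq_of_ne hij] at h1
  have := congrArg Fin.val h1
  simp at this
  omega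

theorem Col.perm_single (τ : Equiv.Perm (Fin k)) (i : Fin k) :
    Col.perm τ (Col.single (M := M) i) = Col.single (τ.symm i) := by
  apply Subtype.ext
  funext x
  rw [Col.perm_apply]
  simp only [Col.single, Pi.single_apply]
  congr 1
  rw [Equiv.eq_symm_apply]

/-- Symmetric weights can be rounded to a symmetric type of any length divisible by `k`; the
rounding error is made up by the orbit of `(M, 0, …, 0)`, which has size `k`. -/
theorem exists_symmetric_type (hk : 1 ≤ k) (hM : 1 ≤ M) {π : Col k M → ℝ} (hπ : ∀ a, 0 < π a)
    (hπ1 : ∑ a, π a = 1) (hsym : ∀ τ a, π (Col.perm τ a) = π a) {n : ℕ} (hkn : k ∣ n) :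
    ∃ σ : Col k M → ℕ, (∀ τ a, σ (Col.perm τ a) = σ a) ∧ ∑ a, σ a = n ∧
      ∀ a, |(σ a : ℝ) - n * π a| ≤ k + Fintype.card (Col k M) := by
  classical
  have hk0 : (0 : ℝ) < k := by exact_mod_cast hk
  set σ₀ : Col k M → ℕ := fun a => k * ⌊n * π a / k⌋₊ with hσ₀
  have hle : ∀ a, (σ₀ a : ℝ) ≤ n * π a := by
    intro a
    have := Nat.floor_le (show 0 ≤ n * π a / k by have := hπ a; positivity)
    rw [le_div_iff₀ hk0] at this
    simp only [hσ₀]; push_cast; linarith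
  have hge : ∀ a, (n : ℝ) * π a ≤ σ₀ a + k := by
    intro a
    have := (Nat.lt_floor_add_one (n * π a / k)).le
    rw [div_le_iff₀ hk0] at this
    simp only [hσ₀]; push_cast; linarith
  have hsum : ∑ a, σ₀ a ≤ n := by
    have : ∑ a, (σ₀ a : ℝ) ≤ ∑ a, n * π a := sum_le_sum fun a _ => hle a
    rw [← mul_sum, hπ1, mul_one] at this
    exact_mod_cast this
  have hsum' : (n : ℝ) ≤ ∑ a, (σ₀ a : ℝ) + k * Fintype.card (Col k M) := by
    have : ∑ a, n * π a ≤ ∑ a : Col k M, ((σ₀ a : ℝ) + k) := sum_le_sum fun a _ => hge a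
    rw [← mul_sum, hπ1, mul_one, sum_add_distrib, sum_const, card_univ, nsmul_eq_mul] at this
    linarith
  obtain ⟨q, hq⟩ : k ∣ n - ∑ a, σ₀ a :=
    Nat.dvd_sub hkn (dvd_sum fun a _ => dvd_mul_right k _)
  have hqA : (q : ℝ) ≤ Fintype.card (Col k M) := by
    have h1 : (n : ℝ) = ∑ a, (σ₀ a : ℝ) + k * q := by
      have : n = ∑ a, σ₀ a + k * q := by omega
      exact_mod_cast this
    have h2 : (k : ℝ) * q ≤ k * Fintype.card (Col k M) := by linarith
    exact le_of_mul_le_mul_left h2 hk0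
  set s : Finset (Col k M) := univ.image Col.single with hs
  have hscard : #s = k := by
    rw [hs, card_image_of_injective _ (Col.single_injective hM), card_univ, Fintype.card_fin]
  have hsperm : ∀ τ a, Col.perm τ a ∈ s ↔ a ∈ s := by
    intro τ a
    simp only [hs, mem_image, mem_univ, true_and]
    constructor
    · rintro ⟨i, hi⟩
      refine ⟨τ i, (Col.perm τ).injective ?_⟩
      rw [← hi, Col.perm_single, Equiv.symm_apply_apply]
    · rintro ⟨i, rfl⟩
      exact ⟨τ.symm i, (Col.perm_single τ i).symm⟩
  refine ⟨fun a => σ₀ a + if a ∈ s then q else 0, ?_, ?_, ?_⟩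
  · intro τ a
    simp only [hσ₀, hsperm, hsym]
  · rw [sum_add_distrib, sum_ite_mem, univ_inter, sum_const, hscard, smul_eq_mul]
    omega
  · intro a
    have h1 := hle a
    have h2 := hge a
    have h3 : (0 : ℝ) ≤ ((if a ∈ s then q else 0 : ℕ) : ℝ) := Nat.cast_nonneg _
    have h4 : ((if a ∈ s then q else 0 : ℕ) : ℝ) ≤ Fintype.card (Col k M) := by
      split_ifs
      · exact hqA
      · exact_mod_cast Nat.zero_le _
    push_cast at h3 h4 ⊢
    rw [abs_le]
    constructor <;> linarith

/-- In a symmetric type every row has the same sum of entries. -/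
theorem sum_entry_of_symmetric {σ : Col k M → ℕ} (hsym : ∀ τ a, σ (Col.perm τ a) = σ a) (i : Fin k) :
    k * ∑ a, σ a * (a.1 i : ℕ) = M * ∑ a, σ a := by
  have h1 : ∀ j, ∑ a, σ a * (a.1 j : ℕ) = ∑ a, σ a * (a.1 i : ℕ) := by
    intro j
    rw [← Equiv.sum_comp (Col.perm (Equiv.swap i j))]
    refine sum_congr rfl fun a _ => ?_
    rw [hsym, Col.perm_apply, Equiv.swap_apply_right]
  calc k * ∑ a, σ a * (a.1 i : ℕ) = ∑ j, ∑ a, σ a * (a.1 j : ℕ) := by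
        rw [sum_congr rfl fun j _ => h1 j, sum_const, card_univ, Fintype.card_fin, smul_eq_mul]
    _ = ∑ a, σ a * ∑ j, (a.1 j : ℕ) := by
        rw [sum_comm]; exact sum_congr rfl fun a _ => (mul_sum _ _ _).symm
    _ = M * ∑ a, σ a := by
        rw [mul_sum]; exact sum_congr rfl fun a _ => by rw [a.2, mul_comm]

end SymmetricTypes

/-! ### Hashing and isolated words -/

section Hashing

variable {k M n p : ℕ}

/-- Distinct words of tuples that agree in some row. -/
def Conflict (t t' : Fin n → Col k M) : Prop :=
  t' ≠ t ∧ ∃ i, ∀ l, (t' l).1 i = (t l).1 i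

/-- The span of the differences of two words of tuples, modulo `p`. -/
def diffSpan (p : ℕ) (t t' : Fin n → Col k M) : Submodule (ZMod p) (Fin k → ZMod p) :=
  Submodule.span (ZMod p) (Set.range fun l => (t' l).toZMod p - (t l).toZMod p)

/-- The linear forms vanishing on `r`-dimensional data are a fraction `p ^ (-r)` of all forms. -/
theorem card_annihilator_mul [Fact p.Prime] (d : Fin n → Fin k → ZMod p) :
    #{a : Fin n → ZMod p | ∑ l, a l • d l = 0} *
      p ^ Module.finrank (ZMod p) (Submodule.span (ZMod p) (Set.range d)) = p ^ n := by
  set f := Fintype.linearCombination (ZMod p) d with hf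
  have h1 : #{a : Fin n → ZMod p | ∑ l, a l • d l = 0} =
      p ^ Module.finrank (ZMod p) (LinearMap.ker f) := by
    have : Fintype (LinearMap.ker f) := Fintype.ofFinite _
    have := Module.card_eq_pow_finrank (K := ZMod p) (V := LinearMap.ker f)
    rw [ZMod.card] at this
    rw [← this, ← Fintype.card_subtype]
    refine Fintype.card_congr (Equiv.subtypeEquivRight fun a => ?_)
    rw [LinearMap.mem_ker, hf, Fintype.linearCombination_apply]
  have h2 : Submodule.span (ZMod p) (Set.range d) = LinearMap.range f :=
    (Fintype.range_linearCombination (ZMod p) d).symm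
  rw [h1, h2, ← pow_add, add_comm, LinearMap.finrank_range_add_finrank_ker,
    Module.finrank_fin_fun]

/-- The affine hash of the rows of a word `t`, normalised at the reference word `t₀`. -/
def rowHash (t₀ : Fin n → Col k M) (ω : (Fin n → ZMod p) × (Fin k → ZMod p))
    (t : Fin n → Col k M) : Fin k → ZMod p :=
  ∑ l, ω.1 l • ((t l).toZMod p - (t₀ l).toZMod p) + ω.2

theorem rowHash_apply (t₀ : Fin n → Col k M) (ω : (Fin n → ZMod p) × (Fin k → ZMod p))
    (t : Fin n → Col k M) (i : Fin k) :
    rowHash t₀ ω t i = ∑ l, ω.1 l * ((t l).toZMod p i - (t₀ l).toZMod p i) + ω.2 i := by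
  simp [rowHash, Finset.sum_apply]

theorem rowHash_congr_row {t₀ t t' : Fin n → Col k M} {ω : (Fin n → ZMod p) × (Fin k → ZMod p)}
    {i : Fin k} (h : ∀ l, (t' l).1 i = (t l).1 i) : rowHash t₀ ω t' i = rowHash t₀ ω t i := by
  rw [rowHash_apply, rowHash_apply]
  simp only [Col.toZMod, h]

/-- The row hashes of every word of tuples add up to zero, since all columns have the same sum. -/
theorem sum_rowHash {t₀ t : Fin n → Col k M} {ω : (Fin n → ZMod p) × (Fin k → ZMod p)}
    (hω : ∑ i, ω.2 i = 0) : ∑ i, rowHash t₀ ω t i = 0 := by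
  simp only [rowHash_apply, sum_add_distrib, hω, add_zero]
  rw [sum_comm]
  refine sum_eq_zero fun l _ => ?_
  rw [← mul_sum, sum_sub_distrib, Col.sum_toZMod, Col.sum_toZMod, sub_self, mul_zero]

theorem card_sum_eq_zero_le [NeZero p] (hk : 1 ≤ k) :
    #{z : Fin k → ZMod p | ∑ i, z i = 0} ≤ p ^ (k - 1) := by
  obtain ⟨k, rfl⟩ : ∃ k', k = k' + 1 := ⟨k - 1, by omega⟩
  have h : Fintype.card (Fin k → ZMod p) = p ^ k := by simp [ZMod.card]
  rw [Nat.add_sub_cancel, ← h, ← card_univ]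
  refine card_le_card_of_injOn (fun z i => z i.succ) (fun _ _ => mem_coe.mpr (mem_univ _)) ?_
  intro z hz z' hz' hzz
  have h1 := (mem_filter.mp hz).2
  have h2 := (mem_filter.mp hz').2
  rw [Fin.sum_univ_succ] at h1 h2
  have h3 : ∀ i : Fin k, z i.succ = z' i.succ := fun i => congrFun hzz i
  simp only [h3] at h1
  funext i
  refine Fin.cases ?_ h3 i
  exact add_right_cancel (h1.trans h2.symm)

/-- A random affine hash into a diagonal family isolates many words of `O`: a word survives if its
hash is a member of the family, and it is isolated if no conflicting word of `T` survives. -/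
theorem exists_isolated_words [Fact p.Prime] (hk : 2 ≤ k) {L : ℕ} {β : Fin L → Fin k → ZMod p}
    (hβ : ∀ j : Fin k → Fin L, ∑ i, β (j i) i = 0 ↔ ∀ i i', j i = j i')
    {O T : Finset (Fin n → Col k M)} (hO : O.Nonempty)
    [∀ t : Fin n → Col k M, DecidablePred (Conflict t)]
    (hconf : ∀ t ∈ O, ∑ t' ∈ T with Conflict t t',
      ((p : ℝ) ^ Module.finrank (ZMod p) (diffSpan p t t'))⁻¹ ≤ 1 / 2) :
    ∃ I ⊆ O, (#O : ℝ) * L / (2 * p ^ (k - 1)) ≤ #I ∧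
      ∀ s : Fin k → Fin n → Col k M, (∀ i, s i ∈ I) → ∀ t' ∈ T,
        (∀ i l, (t' l).1 i = (s i l).1 i) → ∀ i, s i = t' := by
  classical
  obtain ⟨t₀, -⟩ := hO
  have hp0 : (0 : ℝ) < p := by exact_mod_cast (Fact.out : p.Prime).pos
  have hβinj : ∀ j j' i, β j i = β j' i → j = j' := by
    intro j j' i h
    have h0 := (hβ fun _ => j).mpr fun _ _ => rfl
    have h1 : ∑ i', β (Function.update (fun _ => j) i j' i') i' = 0 := by
      rw [← h0]
      refine sum_congr rfl fun i' _ => ?_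
      by_cases hi : i' = i
      · subst hi; rw [Function.update_self, h]
      · rw [Function.update_of_ne hi]
    have h2 := (hβ _).mp h1
    have : Nontrivial (Fin k) := Fin.nontrivial_iff_two_le.mpr hk
    obtain ⟨i', hi'⟩ := exists_ne i
    have h3 := h2 i' i
    rwa [Function.update_of_ne hi', Function.update_self] at h3
  set Z : Finset (Fin k → ZMod p) := {z | ∑ i, z i = 0} with hZ
  set Ω : Finset ((Fin n → ZMod p) × (Fin k → ZMod p)) := univ ×ˢ Z with hΩ
  have hΩcard : (#Ω : ℝ) ≤ p ^ n * p ^ (k - 1) := by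
    have h1 : #Ω ≤ p ^ n * p ^ (k - 1) := by
      rw [hΩ, card_product, card_univ, Fintype.card_fun, ZMod.card, Fintype.card_fin]
      exact Nat.mul_le_mul_left _ (card_sum_eq_zero_le (by omega))
    exact_mod_cast h1
  have hΩne : 0 < #Ω := card_pos.mpr ⟨(0, 0), by simp [hΩ, hZ]⟩
  have hΩsum : ∀ ω ∈ Ω, ∑ i, ω.2 i = 0 := fun ω hω => (mem_filter.mp (mem_product.mp hω).2).2
  let Surv : (Fin n → ZMod p) × (Fin k → ZMod p) → (Fin n → Col k M) → Prop :=
    fun ω t => ∃ j, rowHash t₀ ω t = β j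
  -- given the linear part and a member of the family, exactly one shift makes `t` survive with it
  have hone : ∀ t, (p : ℝ) ^ n * L ≤ #{ω ∈ Ω | Surv ω t} := by
    intro t
    have h1 : Fintype.card ((Fin n → ZMod p) × Fin L) ≤ #{ω ∈ Ω | Surv ω t} := by
      rw [← card_univ]
      refine card_le_card_of_injOn
        (fun x => (x.1, β x.2 - ∑ l, x.1 l • ((t l).toZMod p - (t₀ l).toZMod p))) ?_ ?_
      · rintro ⟨a, j⟩ -
        refine mem_filter.mpr ⟨mem_product.mpr ⟨mem_univ _, mem_filter.mpr ⟨mem_univ _, ?_⟩⟩, j, ?_⟩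
        · have h2 := sum_rowHash (t₀ := t₀) (t := t) (ω := (a, (0 : Fin k → ZMod p))) (by simp)
          simp only [rowHash, add_zero] at h2
          simp only [Pi.sub_apply, sum_sub_distrib]
          rw [(hβ fun _ => j).mpr fun _ _ => rfl, zero_sub, neg_eq_zero]
          simpa using h2
        · simp [rowHash]
      · rintro ⟨a, j⟩ - ⟨a', j'⟩ - h
        simp only [Prod.mk.injEq] at h
        obtain ⟨rfl, h⟩ := h
        have h3 := sub_left_injective h
        have : j = j' := hβinj j j' ⟨0, by omega⟩ (congrFun h3 _)
        rw [this]
    rw [Fintype.card_prod, Fintype.card_fun, ZMod.card, Fintype.card_fin, Fintype.card_fin] at h1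
    exact_mod_cast h1
  -- conflicting words share a row hash, hence survive only with the same member of the family
  have htwo : ∀ t t', Conflict t t' → (#{ω ∈ Ω | Surv ω t ∧ Surv ω t'} : ℝ) ≤
      p ^ n * L * ((p : ℝ) ^ Module.finrank (ZMod p) (diffSpan p t t'))⁻¹ := by
    rintro t t' ⟨-, i, hi⟩
    have h1 : #{ω ∈ Ω | Surv ω t ∧ Surv ω t'} ≤
        #(({a : Fin n → ZMod p | ∑ l, a l • ((t' l).toZMod p - (t l).toZMod p) = 0} : Finset _) ×ˢ
          (univ : Finset (Fin L))) := by
      refine card_le_card_of_surjOn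
        (fun x => (x.1, β x.2 - ∑ l, x.1 l • ((t l).toZMod p - (t₀ l).toZMod p))) ?_
      rintro ⟨a, z⟩ hω
      obtain ⟨-, ⟨j, hj⟩, ⟨j', hj'⟩⟩ := mem_filter.mp hω
      have h2 : β j' i = β j i := by
        rw [← hj, ← hj', rowHash_congr_row hi]
      obtain rfl := hβinj _ _ _ h2
      refine ⟨(a, j'), mem_coe.mpr (mem_product.mpr ⟨mem_filter.mpr ⟨mem_univ _, ?_⟩,
        mem_univ _⟩), ?_⟩
      · have h3 := hj'.trans hj.symm
        simp only [rowHash] at h3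
        have h4 := add_right_cancel h3
        rw [← sub_eq_zero, ← sum_sub_distrib] at h4
        rw [← h4]
        refine sum_congr rfl fun l _ => ?_
        rw [← smul_sub, sub_sub_sub_cancel_right]
      · simp only [Prod.mk.injEq, true_and]
        rw [← hj]
        simp [rowHash]
    rw [card_product, card_univ, Fintype.card_fin] at h1
    have h2 := card_annihilator_mul (p := p) fun l => (t' l).toZMod p - (t l).toZMod p
    have h3 : (#{a : Fin n → ZMod p | ∑ l, a l • ((t' l).toZMod p - (t l).toZMod p) = 0} : ℝ) *
        p ^ Module.finrank (ZMod p) (diffSpan p t t') = p ^ n := by exact_mod_cast h2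
    have h4 : (#{ω ∈ Ω | Surv ω t ∧ Surv ω t'} : ℝ) ≤
        #{a : Fin n → ZMod p | ∑ l, a l • ((t' l).toZMod p - (t l).toZMod p) = 0} * L := by
      exact_mod_cast h1
    refine h4.trans (le_of_eq ?_)
    rw [← h3]
    field_simp
  -- the expected number of surviving words, minus the expected number of surviving conflicts
  have havg : (#O : ℝ) * (p ^ n * L) / 2 ≤ ∑ ω ∈ Ω, ∑ t ∈ O, ((if Surv ω t then (1 : ℝ) else 0) -
      ∑ t' ∈ T with Conflict t t', if Surv ω t ∧ Surv ω t' then (1 : ℝ) else 0) := by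
    rw [sum_comm, show (#O : ℝ) * (p ^ n * L) / 2 = ∑ t ∈ O, ((p : ℝ) ^ n * L / 2) by
      rw [sum_const, nsmul_eq_mul]; ring]
    refine sum_le_sum fun t ht => ?_
    rw [sum_sub_distrib, sum_comm, ← sum_filter, sum_const, nsmul_eq_mul, mul_one]
    have h1 := hone t
    have h2 : ∑ t' ∈ T with Conflict t t', ∑ ω ∈ Ω, (if Surv ω t ∧ Surv ω t' then (1 : ℝ) else 0) ≤
        p ^ n * L * (1 / 2) := by
      refine le_trans ?_ (mul_le_mul_of_nonneg_left (hconf t ht) (by positivity))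
      rw [mul_sum]
      refine sum_le_sum fun t' ht' => ?_
      rw [← sum_filter, sum_const, nsmul_eq_mul, mul_one]
      exact htwo t t' (mem_filter.mp ht').2
    linarith
  obtain ⟨ω, hωΩ, hω⟩ : ∃ ω ∈ Ω, (#O : ℝ) * L / (2 * p ^ (k - 1)) ≤
      ∑ t ∈ O, ((if Surv ω t then (1 : ℝ) else 0) -
        ∑ t' ∈ T with Conflict t t', if Surv ω t ∧ Surv ω t' then (1 : ℝ) else 0) := by
    refine exists_le_of_sum_le (card_pos.mp hΩne) (le_trans ?_ havg)
    rw [sum_const, nsmul_eq_mul]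
    calc (#Ω : ℝ) * ((#O : ℝ) * L / (2 * p ^ (k - 1)))
        ≤ (p ^ n * p ^ (k - 1)) * ((#O : ℝ) * L / (2 * p ^ (k - 1))) :=
          mul_le_mul_of_nonneg_right hΩcard (by positivity)
      _ = _ := by field_simp
  refine ⟨O.filter fun t => Surv ω t ∧ ∀ t' ∈ T, Conflict t t' → ¬ Surv ω t', filter_subset _ _,
    hω.trans ?_, ?_⟩
  · rw [card_filter, Nat.cast_sum]
    refine sum_le_sum fun t _ => ?_
    have hnn : ∀ t' ∈ T.filter (Conflict t),
        (0 : ℝ) ≤ if Surv ω t ∧ Surv ω t' then (1 : ℝ) else 0 := fun t' _ => by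
      split_ifs <;> norm_num
    by_cases h1 : Surv ω t
    · by_cases h2 : ∀ t' ∈ T, Conflict t t' → ¬ Surv ω t'
      · rw [if_pos h1, if_pos ⟨h1, h2⟩, Nat.cast_one]
        linarith [sum_nonneg hnn]
      · rw [if_pos h1, if_neg fun h => h2 h.2, Nat.cast_zero]
        push Not at h2
        obtain ⟨t', ht', hc, hs⟩ := h2
        have := single_le_sum hnn (mem_filter.mpr ⟨ht', hc⟩)
        rw [if_pos ⟨h1, hs⟩] at this
        linarith
    · rw [if_neg h1, if_neg fun h => h1 h.1, Nat.cast_zero]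
      linarith [sum_nonneg hnn]
  · intro s hs t' ht' hrow i
    choose j hj using fun i => (mem_filter.mp (hs i)).2.1
    have h1 : ∀ i, rowHash t₀ ω t' i = β (j i) i := fun i => by
      rw [← hj i]; exact rowHash_congr_row (hrow i)
    have h2 := sum_rowHash (t₀ := t₀) (t := t') (hΩsum ω hωΩ)
    simp only [h1] at h2
    have h3 := (hβ j).mp h2
    by_contra hne
    refine (mem_filter.mp (hs i)).2.2 t' ht' ⟨fun h => hne h.symm, i, hrow i⟩ ⟨j i, ?_⟩
    funext i'
    rw [h1, h3 i' i]

end Hashing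

section ConflictBound

variable {k M n p : ℕ}

theorem diffSpan_le_zeroSumAt {t t' : Fin n → Col k M} {i : Fin k}
    (h : ∀ l, (t' l).1 i = (t l).1 i) : diffSpan p t t' ≤ zeroSumAt p i := by
  rw [diffSpan, Submodule.span_le]
  rintro _ ⟨l, rfl⟩
  refine mem_zeroSumAt.mpr ⟨?_, ?_⟩
  · simp [Col.toZMod, h l]
  · simp [sum_sub_distrib, Col.sum_toZMod]

theorem diffSpan_ne_bot (hMp : M < p) {t t' : Fin n → Col k M} (h : t' ≠ t) :
    diffSpan p t t' ≠ ⊥ := by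
  intro hbot
  apply h
  funext l
  apply Col.toZMod_injective hMp
  have : (t' l).toZMod p - (t l).toZMod p ∈ diffSpan p t t' := Submodule.subset_span ⟨l, rfl⟩
  rw [hbot, Submodule.mem_bot, sub_eq_zero] at this
  exact this

theorem cosetRel_diffSpan (t t' : Fin n → Col k M) (l : Fin n) :
    cosetRel M (diffSpan p t t') (t l) (t' l) := by
  rw [cosetRel_iff, ← neg_sub]
  exact Submodule.neg_mem _ (Submodule.subset_span ⟨l, rfl⟩)

/-- The expected number of conflicts with a word of type `σ`: conflicts are classified by the span
of the differences, for which there are boundedly many possibilities. -/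
theorem sum_conflict_le [Fact p.Prime] (hk : 3 ≤ k) (hkp : k < p) (hMp : M < p)
    {π : Col k M → ℝ} (hπ : ∀ a, 0 < π a) (hπ1 : ∑ a, π a = 1)
    (hsym : ∀ τ a, π (Col.perm τ a) = π a) {δ : ℝ}
    (hδ : ∀ i : Fin k, (∑ a, π a * (Real.log (∑ b : Col k M, if b.1 i = a.1 i then π b else 0) -
      Real.log (π a))) / (k - 2) = δ)
    {σ : Col k M → ℕ} {c : ℝ} (hc : ∀ a, |(σ a : ℝ) - n * π a| ≤ c)
    (hpδ : 2 * 2 ^ (Fintype.card (Col k M) ^ 2) * Real.exp (c * ∑ a, |Real.log (π a)|) *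
      Real.exp (n * δ) ≤ p)
    {t : Fin n → Col k M} (ht : t ∈ typeClass n σ) {T : Finset (Fin n → Col k M)}
    (hT : ∀ t' ∈ T, ∏ l, π (t' l) = ∏ l, π (t l)) [DecidablePred (Conflict t)] :
    ∑ t' ∈ T with Conflict t t',
      ((p : ℝ) ^ Module.finrank (ZMod p) (diffSpan p t t'))⁻¹ ≤ 1 / 2 := by
  classical
  set C₁ := Real.exp (c * ∑ a, |Real.log (π a)|) with hC₁
  set Q : ℝ := 2 ^ (Fintype.card (Col k M) ^ 2) with hQ
  have hp0 : (0 : ℝ) < p := by exact_mod_cast (Fact.out : p.Prime).pos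
  have hQ1 : 1 ≤ Q := one_le_pow₀ (by norm_num)
  have hc0 : 0 ≤ c := (abs_nonneg _).trans (hc (Col.single ⟨0, by omega⟩))
  have hC1 : 1 ≤ C₁ := Real.one_le_exp (mul_nonneg hc0 (sum_nonneg fun _ _ => abs_nonneg _))
  let spanOf : Finset (Col k M × Col k M) → Submodule (ZMod p) (Fin k → ZMod p) := fun R =>
    Submodule.span (ZMod p) ((fun x : Col k M × Col k M => x.2.toZMod p - x.1.toZMod p) '' R)
  set 𝒰 : Finset (Submodule (ZMod p) (Fin k → ZMod p)) := univ.image spanOf with h𝒰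
  have hcard : (#𝒰 : ℝ) ≤ Q := by
    have : #𝒰 ≤ 2 ^ (Fintype.card (Col k M) ^ 2) := by
      refine card_image_le.trans ?_
      rw [card_univ, Fintype.card_finset, Fintype.card_prod, sq]
    rw [hQ]
    exact_mod_cast this
  have hmaps : ∀ t' ∈ T.filter (Conflict t), diffSpan p t t' ∈ 𝒰 := by
    intro t' _
    refine mem_image.mpr ⟨univ.image fun l => (t l, t' l), mem_univ _, ?_⟩
    simp only [spanOf, diffSpan]
    congr 1
    ext u
    simp
  rw [← sum_fiberwise_of_maps_to hmaps]
  have hterm : ∀ U ∈ 𝒰, ∑ t' ∈ T.filter (Conflict t) with diffSpan p t t' = U,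
      ((p : ℝ) ^ Module.finrank (ZMod p) (diffSpan p t t'))⁻¹ ≤ 1 / (2 * Q) := by
    intro U _
    rcases ((T.filter (Conflict t)).filter fun t' => diffSpan p t t' = U).eq_empty_or_nonempty
      with h | ⟨s, hs⟩
    · rw [h, sum_empty]; positivity
    · obtain ⟨hs1, rfl⟩ := mem_filter.mp hs
      obtain ⟨-, hne, i, hi⟩ := mem_filter.mp hs1
      set U := diffSpan p t s with hU
      set r := Module.finrank (ZMod p) U with hr
      have hr1 : r ≠ 0 := by
        rw [hr, Ne, Submodule.finrank_eq_zero]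
        exact diffSpan_ne_bot hMp hne
      have h1 := card_equiv_words_le hπ hπ1 hc ht (cosetRel M U)
        ((T.filter (Conflict t)).filter fun t' => diffSpan p t t' = U) (by
          intro t' ht'
          obtain ⟨ht1, ht2⟩ := mem_filter.mp ht'
          refine ⟨hT t' (mem_filter.mp ht1).1, fun l => ?_⟩
          rw [← ht2]
          exact cosetRel_diffSpan t t' l)
      have h2 := entropy_deficit_le hk hkp hMp hπ hsym i (diffSpan_le_zeroSumAt (p := p) hi)
      rw [hδ i] at h2
      have h3 : (#((T.filter (Conflict t)).filter fun t' => diffSpan p t t' = U) : ℝ) ≤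
          Real.exp (n * δ) ^ r * C₁ := by
        refine h1.trans ?_
        rw [hC₁, ← Real.exp_nat_mul, ← Real.exp_add]
        refine Real.exp_le_exp.mpr (add_le_add_left ?_ _)
        calc (n : ℝ) * _ ≤ n * (r * δ) := mul_le_mul_of_nonneg_left h2 (Nat.cast_nonneg _)
          _ = _ := by ring
      have h4 : Real.exp (n * δ) / p ≤ 1 / (2 * Q * C₁) := by
        rw [div_le_div_iff₀ hp0 (by positivity)]
        linarith
      have h5 : 1 / (2 * Q * C₁) ≤ 1 := by
        rw [div_le_one (by positivity)]
        nlinarith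
      rw [sum_congr rfl fun t' ht' => by rw [(mem_filter.mp ht').2], sum_const, nsmul_eq_mul]
      calc _ ≤ Real.exp (n * δ) ^ r * C₁ * ((p : ℝ) ^ r)⁻¹ :=
            mul_le_mul_of_nonneg_right h3 (by positivity)
        _ = C₁ * (Real.exp (n * δ) / p) ^ r := by rw [div_pow]; ring
        _ ≤ C₁ * (Real.exp (n * δ) / p) :=
            mul_le_mul_of_nonneg_left (pow_le_of_le_one (by positivity) (h4.trans h5) hr1)
              (by positivity)
        _ ≤ C₁ * (1 / (2 * Q * C₁)) := mul_le_mul_of_nonneg_left h4 (by positivity)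
        _ = 1 / (2 * Q) := by field_simp
  refine (sum_le_sum hterm).trans ?_
  rw [sum_const, nsmul_eq_mul]
  calc (#𝒰 : ℝ) * (1 / (2 * Q)) ≤ Q * (1 / (2 * Q)) :=
        mul_le_mul_of_nonneg_right hcard (by positivity)
    _ = 1 / 2 := by field_simp

end ConflictBound

/-! ### Parameters and conclusion -/

section CriticalPoint

/-- The ratio at which the geometric distribution on `{0, …, M}` has mean `M / k`. -/
theorem exists_critical_ratio {k M : ℕ} (hk : 3 ≤ k) (hM : 1 ≤ M) :
    ∃ γ ∈ Set.Ioo (0 : ℝ) 1, ∑ v ∈ range (M + 1), γ ^ v * ((k : ℝ) * v - M) = 0 := by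
  have hM0 : (1 : ℝ) ≤ M := by exact_mod_cast hM
  have hk0 : (3 : ℝ) ≤ k := by exact_mod_cast hk
  have hc : ContinuousOn (fun γ : ℝ => ∑ v ∈ range (M + 1), γ ^ v * ((k : ℝ) * v - M))
      (Set.Icc 0 1) := by fun_prop
  refine intermediate_value_Ioo zero_le_one hc ⟨?_, ?_⟩
  · rw [sum_range_succ']
    simp
    omega
  · simp only [one_pow, one_mul]
    rw [sum_range_slope]
    have : 0 < ((k : ℝ) - 2) * M := mul_pos (by linarith) (by linarith)
    have : 0 < ((M : ℝ) + 1) * (k * M - 2 * M) := mul_pos (by linarith) (by linarith)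
    linarith

theorem Gam_le {M k : ℕ} {γ : ℝ} (hγ : γ ∈ Set.Ioo (0 : ℝ) 1) :
    Gam (M + 1) k ≤ (∑ i ∈ range (M + 1), γ ^ i) / γ ^ ((M : ℝ) / k) := by
  have h : (((M + 1 : ℕ) : ℝ) - 1) = M := by push_cast; ring
  unfold Gam
  rw [h]
  refine csInf_le ⟨0, ?_⟩ ⟨γ, hγ, rfl⟩
  rintro _ ⟨x, hx, rfl⟩
  exact div_nonneg (sum_nonneg fun i _ => pow_nonneg hx.1.le i) (Real.rpow_nonneg hx.1.le _)

theorem Gam_nonneg (m k : ℕ) : 0 ≤ Gam m k := by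
  refine Real.sInf_nonneg ?_
  rintro _ ⟨x, hx, rfl⟩
  exact div_nonneg (sum_nonneg fun i _ => pow_nonneg hx.1.le i) (Real.rpow_nonneg hx.1.le _)

end CriticalPoint

section Construction

variable {k M n : ℕ}

theorem prod_comp_of_mem_typeClass {A : Type*} [Fintype A] [DecidableEq A] {σ : A → ℕ}
    {t : Fin n → A} (ht : t ∈ typeClass n σ) (g : A → ℝ) : ∏ l, g (t l) = ∏ a, g a ^ σ a := by
  rw [← prod_fiberwise univ t]
  refine prod_congr rfl fun a _ => ?_
  rw [prod_congr rfl fun l hl => by rw [(mem_filter.mp hl).2], prod_const, mem_typeClass.mp ht]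

/-- For product weights, recombining rows of words of the same type does not change the weight;
hence the isolated words of a type class form the desired collection of tuples. -/
theorem exists_collection {p : ℕ} [Fact p.Prime] (hk : 3 ≤ k) (hkp : k < p) (hMp : M < p)
    {f : Fin (M + 1) → ℝ} (hf : ∀ v, 0 < f v) {π : Col k M → ℝ} (hπf : ∀ a, π a = ∏ i, f (a.1 i))
    (hπ1 : ∑ a, π a = 1) {δ : ℝ}
    (hδ : ∀ i : Fin k, (∑ a, π a * (Real.log (∑ b : Col k M, if b.1 i = a.1 i then π b else 0) -
      Real.log (π a))) / (k - 2) = δ)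
    {σ : Col k M → ℕ} (hσ : ∑ a, σ a = n) (hσsym : ∀ τ a, σ (Col.perm τ a) = σ a)
    {c : ℝ} (hc : ∀ a, |(σ a : ℝ) - n * π a| ≤ c)
    (hpδ : 2 * 2 ^ (Fintype.card (Col k M) ^ 2) * Real.exp (c * ∑ a, |Real.log (π a)|) *
      Real.exp (n * δ) ≤ p)
    {L₀ : ℕ} {β : Fin L₀ → Fin k → ZMod p}
    (hβ : ∀ j : Fin k → Fin L₀, ∑ i, β (j i) i = 0 ↔ ∀ i i', j i = j i') :
    ∃ (L : ℕ) (x : Fin k → Fin L → (Fin n → ℤ)),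
      (#(typeClass n σ) : ℝ) * L₀ / (2 * p ^ (k - 1)) ≤ L ∧
      (∀ j : Fin k → Fin L, (∑ i, x i (j i) = fun _ => (M : ℤ)) ↔ ∀ i i', j i = j i') ∧
      (∀ i j l, 0 ≤ x i j l ∧ x i j l ≤ M) ∧
      ∀ i j, (k : ℤ) * ∑ l, x i j l = M * n := by
  classical
  have hπ : ∀ a, 0 < π a := fun a => by rw [hπf]; exact prod_pos fun i _ => hf _
  have hsym : ∀ τ a, π (Col.perm τ a) = π a := fun τ a => by
    rw [hπf, hπf]
    exact Equiv.prod_comp τ fun i => f (a.1 i)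
  set T : Finset (Fin n → Col k M) := {t | ∏ l, π (t l) = ∏ a, π a ^ σ a} with hT
  obtain ⟨I, hsubI, hI, hmatch⟩ := exists_isolated_words (T := T) (by omega) hβ
    (typeClass_nonempty hσ) fun t ht => sum_conflict_le hk hkp hMp hπ hπ1 hsym hδ hc hpδ ht
      fun t' ht' => by rw [(mem_filter.mp ht').2, prod_comp_of_mem_typeClass ht]
  let w : Fin #I → Fin n → Col k M := fun j => (I.equivFin.symm j).1
  have hwI : ∀ j, w j ∈ I := fun j => (I.equivFin.symm j).2
  have hwinj : ∀ j j', w j = w j' → j = j' := fun j j' h =>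
    I.equivFin.symm.injective (Subtype.ext h)
  refine ⟨#I, fun i j l => (((w j l).1 i : ℕ) : ℤ), hI, fun j => ⟨fun h => ?_, fun h => ?_⟩,
    fun i j l => ⟨Int.natCast_nonneg _, ?_⟩, fun i j => ?_⟩
  · have hcol : ∀ l, ∑ i, ((w (j i) l).1 i : ℕ) = M := by
      intro l
      have := congrFun h l
      rw [Finset.sum_apply] at this
      beta_reduce at this
      exact_mod_cast this
    let t' : Fin n → Col k M := fun l => ⟨fun i => (w (j i) l).1 i, hcol l⟩
    have ht' : t' ∈ T := by
      refine mem_filter.mpr ⟨mem_univ _, ?_⟩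
      calc ∏ l, π (t' l) = ∏ i, ∏ l, f ((w (j i) l).1 i) := by
            rw [prod_comm]; exact prod_congr rfl fun l _ => hπf _
        _ = ∏ i, ∏ a : Col k M, f (a.1 i) ^ σ a := prod_congr rfl fun i _ =>
            prod_comp_of_mem_typeClass (hsubI (hwI (j i))) fun a => f (a.1 i)
        _ = ∏ a, π a ^ σ a := by
            rw [prod_comm]
            exact prod_congr rfl fun a _ => by rw [prod_pow, hπf]
    have h1 := hmatch (fun i => w (j i)) (fun i => hwI _) t' ht' fun i l => rfl
    intro i i'
    exact hwinj _ _ ((h1 i).trans (h1 i').symm)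
  · funext l
    rw [Finset.sum_apply]
    have i₀ : Fin k := ⟨0, by omega⟩
    rw [sum_congr rfl fun i _ => by rw [h i i₀]]
    beta_reduce
    exact_mod_cast (w (j i₀) l).2
  · beta_reduce
    exact_mod_cast Nat.le_of_lt_succ ((w j l).1 i).2
  · rw [sum_comp_of_mem_typeClass (R := ℤ) (hsubI (hwI j)) fun a => (((a.1 i : ℕ)) : ℤ)]
    have := sum_entry_of_symmetric hσsym i
    rw [hσ] at this
    exact_mod_cast this

end Construction

section Asymptotics

theorem natCeil_sqrt_bounds {n : ℕ} (hn : 1 ≤ n) :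
    1 ≤ ⌈Real.sqrt n⌉₊ ∧ Real.sqrt n ≤ ⌈Real.sqrt n⌉₊ ∧
      (⌈Real.sqrt n⌉₊ : ℝ) ≤ Real.sqrt n + 1 := by
  have h1 : 0 < Real.sqrt n := Real.sqrt_pos.mpr (by exact_mod_cast hn)
  exact ⟨Nat.one_le_iff_ne_zero.mpr (Nat.ceil_pos.mpr h1).ne', Nat.le_ceil _,
    (Nat.ceil_lt_add_one h1.le).le⟩

/-- The choice of the modulus and of the parameters of Behrend's construction. -/
theorem exists_modulus {k K n : ℕ} (hk : 2 ≤ k) (hK : 1 ≤ K) (hn : 1 ≤ n) {δ : ℝ} (hδ : 0 ≤ δ) :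
    ∃ (p N d : ℕ), p.Prime ∧ 1 ≤ N ∧ 1 ≤ d ∧ K < p ∧ k < p ∧ k * (k * d) ^ N < p ∧
      K * Real.exp (n * δ) ≤ p ∧
      Real.log p ≤ Real.log (2 * K * k) + N * Real.log k + N * Real.log d ∧
      (N : ℝ) ≤ 2 * Real.sqrt n ∧ Real.log d ≤ Real.log 2 + Real.sqrt n * δ ∧
      N * Real.log d ≤ n * δ + Real.sqrt n * δ + 2 * Real.sqrt n * Real.log 2 := by
  obtain ⟨hN1, hN2, hN3⟩ := natCeil_sqrt_bounds hn
  set N := ⌈Real.sqrt n⌉₊ with hN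
  set s := Real.sqrt n with hs
  have hs1 : 1 ≤ s := Real.one_le_sqrt.mpr (by exact_mod_cast hn)
  have hss : s * s = n := Real.mul_self_sqrt (Nat.cast_nonneg n)
  set E := Real.exp (s * δ) with hE
  have hE1 : 1 ≤ E := Real.one_le_exp (mul_nonneg (by linarith) hδ)
  set d := ⌈E⌉₊ with hd
  have hEd : E ≤ d := Nat.le_ceil _
  have hdE : (d : ℝ) ≤ 2 * E := by
    have := (Nat.ceil_lt_add_one (show 0 ≤ E by linarith)).le
    linarith
  have hd1 : 1 ≤ d := by
    have : (1 : ℝ) ≤ d := hE1.trans hEd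
    exact_mod_cast this
  have hd0 : (0 : ℝ) < d := by exact_mod_cast hd1
  have hk0 : (0 : ℝ) < k := by
    have : 0 < k := by omega
    exact_mod_cast this
  have hK0 : (0 : ℝ) < K := by exact_mod_cast hK
  have hkd : 1 ≤ (k * d) ^ N := Nat.one_le_pow _ _ (Nat.mul_pos (by omega) hd1)
  obtain ⟨p, hp, hp1, hp2⟩ := Nat.exists_prime_lt_and_le_two_mul (K * k * (k * d) ^ N)
    (Nat.mul_ne_zero (Nat.mul_ne_zero (by omega) (by omega)) (by omega))
  have hlogd : Real.log d ≤ Real.log 2 + s * δ := by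
    have := Real.log_le_log hd0 hdE
    rwa [Real.log_mul two_ne_zero (by positivity), hE, Real.log_exp] at this
  have hN4 : (N : ℝ) ≤ 2 * s := by linarith
  refine ⟨p, N, d, hp, hN1, hd1, ?_, ?_, ?_, ?_, ?_, hN4, hlogd, ?_⟩
  · refine lt_of_le_of_lt ?_ hp1
    calc K = K * 1 * 1 := by ring
      _ ≤ K * k * (k * d) ^ N := Nat.mul_le_mul (Nat.mul_le_mul_left _ (by omega)) hkd
  · refine lt_of_le_of_lt ?_ hp1
    calc k = 1 * k * 1 := by ring
      _ ≤ K * k * (k * d) ^ N := Nat.mul_le_mul (Nat.mul_le_mul_right _ hK) hkd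
  · refine lt_of_le_of_lt ?_ hp1
    exact Nat.mul_le_mul_right _ (Nat.le_mul_of_pos_left _ hK)
  · have h1 : ((K * k * (k * d) ^ N : ℕ) : ℝ) ≤ p := by exact_mod_cast hp1.le
    refine le_trans ?_ h1
    have h2 : Real.exp (n * δ) ≤ (d : ℝ) ^ N := by
      calc Real.exp (n * δ) ≤ Real.exp (N * (s * δ)) := by
            rw [← hss, mul_assoc]
            exact Real.exp_le_exp.mpr
              (mul_le_mul_of_nonneg_right hN2 (mul_nonneg (by linarith) hδ))
        _ = E ^ N := by rw [hE, ← Real.exp_nat_mul]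
        _ ≤ (d : ℝ) ^ N := pow_le_pow_left₀ (by linarith) hEd N
    have hk1 : (1 : ℝ) ≤ k := by
      have : 1 ≤ k := by omega
      exact_mod_cast this
    have h3 : (d : ℝ) ^ N ≤ k * (k * d) ^ N := by
      calc (d : ℝ) ^ N = 1 * (1 * d) ^ N := by ring
        _ ≤ k * (k * d) ^ N := by gcongr
    push_cast
    rw [mul_assoc]
    exact mul_le_mul_of_nonneg_left (h2.trans h3) hK0.le
  · have h1 : (p : ℝ) ≤ 2 * K * k * ((k : ℝ) ^ N * (d : ℝ) ^ N) := by
      have : (p : ℝ) ≤ ((2 * (K * k * (k * d) ^ N) : ℕ) : ℝ) := by exact_mod_cast hp2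
      refine this.trans (le_of_eq ?_)
      push_cast
      rw [mul_pow]; ring
    have h2 := Real.log_le_log (by exact_mod_cast hp.pos) h1
    rw [Real.log_mul (x := 2 * K * k) (by positivity) (by positivity),
      Real.log_mul (x := (k : ℝ) ^ N) (by positivity) (by positivity),
      Real.log_pow, Real.log_pow] at h2
    linarith
  · have hlog2 : 0 ≤ Real.log 2 := Real.log_nonneg (by norm_num)
    calc N * Real.log d ≤ N * (Real.log 2 + s * δ) :=
          mul_le_mul_of_nonneg_left hlogd (Nat.cast_nonneg _)
      _ = N * Real.log 2 + N * (s * δ) := by ring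
      _ ≤ 2 * s * Real.log 2 + (s + 1) * (s * δ) :=
          add_le_add (mul_le_mul_of_nonneg_right hN4 hlog2)
            (mul_le_mul_of_nonneg_right hN3 (mul_nonneg (by linarith) hδ))
      _ = n * δ + s * δ + 2 * s * Real.log 2 := by rw [← hss]; ring

/-- The symmetric product weights whose marginals are the geometric distribution of mean `M / k`;
`h` is the entropy of that distribution. -/
theorem exists_geometric_weights {k M : ℕ} (hk : 3 ≤ k) (hM : 1 ≤ M) :
    ∃ (h : ℝ) (f : Fin (M + 1) → ℝ), 0 < h ∧ Gam (M + 1) k ≤ Real.exp h ∧ (∀ v, 0 < f v) ∧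
      ∑ a : Col k M, ∏ i, f (a.1 i) = 1 ∧
      ∀ i : Fin k, ∑ a : Col k M, (∏ i, f (a.1 i)) *
        Real.log (∑ b : Col k M, if b.1 i = a.1 i then ∏ i, f (b.1 i) else 0) = - h := by
  obtain ⟨γ, hγ, hcrit⟩ := exists_critical_ratio hk hM
  have hk0 : (0 : ℝ) < k := by
    have : 0 < k := by omega
    exact_mod_cast this
  set Z := ∑ v ∈ range (M + 1), γ ^ v with hZ
  have hZ1 : 1 < Z := by
    rw [hZ, sum_range_succ', pow_zero]
    have : 0 < ∑ v ∈ range M, γ ^ (v + 1) :=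
      sum_pos (fun v _ => pow_pos hγ.1 _) ⟨0, mem_range.mpr hM⟩
    linarith
  have hZ0 : 0 < Z := by linarith
  set ψ : ℕ → ℝ := fun v => γ ^ v / Z with hψ
  have hψ0 : ∀ v, 0 < ψ v := fun v => div_pos (pow_pos hγ.1 v) hZ0
  have hψ1 : ∑ v : Fin (M + 1), ψ v = 1 := by
    rw [Fin.sum_univ_eq_sum_range ψ, hψ, ← sum_div, ← hZ, div_self hZ0.ne']
  have hmean : ∑ v ∈ range (M + 1), ψ v * ((k : ℝ) * v - M) = 0 := by
    have : ∑ v ∈ range (M + 1), ψ v * ((k : ℝ) * v - M) =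
        (∑ v ∈ range (M + 1), γ ^ v * ((k : ℝ) * v - M)) / Z := by
      rw [sum_div]; exact sum_congr rfl fun v _ => by rw [hψ]; ring
    rw [this, hcrit, zero_div]
  have hmean' : ∑ v : Fin (M + 1), ψ v * (v : ℕ) = M / k := by
    rw [← Fin.sum_univ_eq_sum_range (fun v => ψ v * ((k : ℝ) * v - M))] at hmean
    simp only [mul_sub, sum_sub_distrib, ← sum_mul, hψ1] at hmean
    rw [eq_div_iff hk0.ne', sum_mul]
    rw [one_mul, sub_eq_zero] at hmean
    rw [← hmean]
    exact sum_congr rfl fun v _ => by ring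
  obtain ⟨f, hf, hfψ⟩ := exists_product_weights hk hM (hψ0 M) (fun v _ => by
    refine div_lt_div_of_pos_right ?_ hZ0
    rw [pow_succ]
    exact mul_lt_of_lt_one_right (pow_pos hγ.1 v) hγ.2) hψ1 hmean
  set π : Col k M → ℝ := fun a => ∏ i, f (a.1 i) with hπ
  have hsym : ∀ τ a, π (Col.perm τ a) = π a := fun τ a => Equiv.prod_comp τ fun i => f (a.1 i)
  have hmarg : ∀ (i : Fin k) v, ∑ a : Col k M, (if a.1 i = v then π a else 0) = ψ v := by
    intro i v
    have h1 : ∀ j, ∑ a : Col k M, (if a.1 j = v then π a else 0) =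
        ∑ a : Col k M, (if a.1 i = v then π a else 0) := by
      intro j
      rw [← Equiv.sum_comp (Col.perm (Equiv.swap i j))]
      refine sum_congr rfl fun a _ => ?_
      rw [hsym, Col.perm_apply, Equiv.swap_apply_right]
    have h2 := hfψ v
    simp only [mul_sum, mul_ite, mul_one, mul_zero] at h2
    rw [sum_comm] at h2
    change ∑ j, ∑ a : Col k M, (if a.1 j = v then π a else 0) = _ at h2
    rw [sum_congr rfl fun j _ => h1 j, sum_const, card_univ, Fintype.card_fin, nsmul_eq_mul] at h2
    exact mul_left_cancel₀ hk0.ne' h2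
  have hexp : ∀ (i : Fin k) (g : Fin (M + 1) → ℝ),
      ∑ a : Col k M, π a * g (a.1 i) = ∑ v : Fin (M + 1), ψ v * g v := by
    intro i g
    simp only [← hmarg i, sum_mul]
    rw [sum_comm]
    refine sum_congr rfl fun a _ => ?_
    simp
  have hlogψ : ∀ v, Real.log (ψ v) = v * Real.log γ - Real.log Z := fun v => by
    rw [hψ, Real.log_div (pow_pos hγ.1 v).ne' hZ0.ne', Real.log_pow]
  have hlogγ : Real.log γ < 0 := Real.log_neg hγ.1 hγ.2
  have hMk : 0 < (M : ℝ) / k := div_pos (by exact_mod_cast hM) hk0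
  refine ⟨Real.log Z - M / k * Real.log γ, f, ?_, ?_, hf, ?_, fun i => ?_⟩
  · have := Real.log_pos hZ1
    nlinarith
  · refine (Gam_le hγ).trans (le_of_eq ?_)
    rw [Real.exp_sub, Real.exp_log hZ0, Real.rpow_def_of_pos hγ.1, mul_comm (Real.log γ)]
  · have := hexp ⟨0, by omega⟩ fun _ => 1
    simpa [hψ1] using this
  · change ∑ a : Col k M, π a * Real.log (∑ b : Col k M, if b.1 i = a.1 i then π b else 0) = _
    simp only [hmarg]
    rw [hexp i fun v => Real.log (ψ v)]
    simp only [hlogψ, mul_sub, sum_sub_distrib, ← sum_mul, hψ1]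
    have : ∑ v : Fin (M + 1), ψ v * ((v : ℕ) * Real.log γ) = M / k * Real.log γ := by
      rw [← hmean', sum_mul]; exact sum_congr rfl fun v _ => by ring
    rw [this]; ring

/-- The collection for `m = M + 1`, with its size in terms of the entropy `h` of the geometric
distribution of mean `M / k`. -/
theorem exists_large_collection {k M : ℕ} (hk : 3 ≤ k) (hM : 1 ≤ M) :
    ∃ h C : ℝ, 0 < h ∧ Gam (M + 1) k ≤ Real.exp h ∧ ∀ n : ℕ, 1 ≤ n → k ∣ n →
      ∃ (L : ℕ) (x : Fin k → Fin L → (Fin n → ℤ)),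
        Real.exp (n * h - C * Real.sqrt n) ≤ L ∧
        (∀ j : Fin k → Fin L, (∑ i, x i (j i) = fun _ => (M : ℤ)) ↔ ∀ i i', j i = j i') ∧
        (∀ i j l, 0 ≤ x i j l ∧ x i j l ≤ M) ∧
        ∀ i j, (k : ℤ) * ∑ l, x i j l = M * n := by
  classical
  obtain ⟨h, f, hh, hGam, hf, hπ1, hent⟩ := exists_geometric_weights hk hM
  set π : Col k M → ℝ := fun a => ∏ i, f (a.1 i) with hπdef
  have hπ : ∀ a, 0 < π a := fun a => prod_pos fun i _ => hf _
  have hsym : ∀ τ a, π (Col.perm τ a) = π a := fun τ a => Equiv.prod_comp τ fun i => f (a.1 i)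
  have hk2 : (0 : ℝ) < (k : ℝ) - 2 := by
    have : (3 : ℝ) ≤ k := by exact_mod_cast hk
    linarith
  set H := - ∑ a, π a * Real.log (π a) with hH
  set δ := (H - h) / ((k : ℝ) - 2) with hδdef
  have hδ : ∀ i : Fin k, (∑ a, π a * (Real.log (∑ b : Col k M, if b.1 i = a.1 i then π b else 0) -
      Real.log (π a))) / (k - 2) = δ := by
    intro i
    have := hent i
    simp only [mul_sub, sum_sub_distrib]
    rw [hδdef, hH]
    congr 1
    linarith
  have hδ0 : 0 ≤ δ := by
    rw [← hδ ⟨0, by omega⟩]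
    refine div_nonneg (sum_nonneg fun a _ => mul_nonneg (hπ a).le (sub_nonneg.mpr ?_)) hk2.le
    refine Real.log_le_log (hπ a) ?_
    have := single_le_sum (f := fun b : Col k M => if b.1 ⟨0, by omega⟩ = a.1 ⟨0, by omega⟩ then π b
      else 0) (fun b _ => by split_ifs; exacts [(hπ b).le, le_rfl]) (mem_univ a)
    simpa using this
  have hδk : ((k : ℝ) - 2) * δ = H - h := by rw [hδdef]; field_simp
  set c : ℝ := k + Fintype.card (Col k M) with hc
  set A : ℝ := ((Fintype.card (Col k M) : ℕ) : ℝ) with hA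
  set C₂ : ℝ := A + c * ∑ a, (1 / π a + |Real.log (π a)|) with hC₂
  obtain ⟨K, hK⟩ := exists_nat_ge (max (2 * 2 ^ (Fintype.card (Col k M) ^ 2) *
    Real.exp (c * ∑ a, |Real.log (π a)|)) (M + 1))
  have hK1 := (le_max_left _ _).trans hK
  have hK2 : M + 1 ≤ K := by exact_mod_cast (le_max_right _ _).trans hK
  have hA0 : 0 ≤ A := Nat.cast_nonneg _
  have hlog2 : 0 ≤ Real.log 2 := Real.log_nonneg (by norm_num)
  have hlogk : 0 ≤ Real.log k := Real.log_natCast_nonneg k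
  have hlogK : 0 ≤ Real.log (2 * K * k) := by exact_mod_cast Real.log_natCast_nonneg (2 * K * k)
  refine ⟨h, 2 * A + |C₂| + 2 + 3 * Real.log 2 + 2 * δ + (k - 1) * (Real.log (2 * K * k) +
    2 * Real.log k) + (k - 2) * (δ + 2 * Real.log 2), hh, hGam, fun n hn hkn => ?_⟩
  obtain ⟨σ, hσsym, hσ, hσc⟩ := exists_symmetric_type (by omega) hM hπ hπ1 hsym hkn
  obtain ⟨p, N, d, hp, hN1, hd1, hKp, hkp, hpB, hpδ, hlogp, hN, hlogd, hNlogd⟩ :=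
    exists_modulus (k := k) (K := K) (by omega) (by omega) hn hδ0
  have : Fact p.Prime := ⟨hp⟩
  obtain ⟨L₀, β, hL₀, hβ⟩ := exists_diagonal_family (by omega) hpB
  obtain ⟨L, x, hL, h1, h2, h3⟩ := exists_collection hk hkp (by omega) hf (π := π) (fun _ => rfl)
    hπ1 hδ hσ hσsym hσc
    ((mul_le_mul_of_nonneg_right hK1 (Real.exp_pos _).le).trans hpδ) hβ
  refine ⟨L, x, le_trans ?_ hL, h1, h2, h3⟩
  have hN0 : (0 : ℝ) < N := by exact_mod_cast hN1
  have hd0 : (0 : ℝ) < d := by exact_mod_cast hd1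
  have hp0 : (0 : ℝ) < p := by exact_mod_cast hp.pos
  have hO0 : (0 : ℝ) < #(typeClass n σ) := by
    exact_mod_cast card_pos.mpr (typeClass_nonempty hσ)
  push_cast at hL₀
  have hB0 : (0 : ℝ) < (d : ℝ) ^ N / (N * d ^ 2) := by positivity
  have hL₀0 : (0 : ℝ) < L₀ := hB0.trans_le hL₀
  rw [← Real.le_log_iff_exp_le (by positivity), Real.log_div (by positivity) (by positivity),
    Real.log_mul hO0.ne' hL₀0.ne', Real.log_mul two_ne_zero (by positivity), Real.log_pow,
    Nat.cast_sub (by omega), Nat.cast_one]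
  have hlogL := Real.log_le_log hB0 hL₀
  rw [Real.log_div (by positivity) (by positivity), Real.log_mul hN0.ne' (by positivity),
    Real.log_pow, Real.log_pow] at hlogL
  push_cast at hlogL
  have hlogO := log_card_typeClass_ge hn hσ hπ hσc
  change n * H - A * Real.log n - C₂ ≤ _ at hlogO
  set s := Real.sqrt n with hs
  have hs1 : 1 ≤ s := Real.one_le_sqrt.mpr (by exact_mod_cast hn)
  have hlogn : Real.log n ≤ 2 * s := by
    have h4 : (n : ℝ) = s ^ 2 := (Real.sq_sqrt (Nat.cast_nonneg n)).symm
    rw [h4, Real.log_pow]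
    have := Real.log_le_sub_one_of_pos (show 0 < s by linarith)
    push_cast
    linarith
  have hlogN : Real.log N ≤ 2 * s := by
    have := Real.log_le_sub_one_of_pos hN0
    linarith
  have hk1 : (0 : ℝ) ≤ (k : ℝ) - 1 := by linarith
  have e1 : A * Real.log n ≤ A * (2 * s) := mul_le_mul_of_nonneg_left hlogn hA0
  have e2 : C₂ ≤ |C₂| * s :=
    (le_abs_self _).trans (le_mul_of_one_le_right (abs_nonneg _) hs1)
  have e3 : Real.log 2 ≤ Real.log 2 * s := le_mul_of_one_le_right hlog2 hs1
  have e4 : Real.log (2 * K * k) ≤ Real.log (2 * K * k) * s := le_mul_of_one_le_right hlogK hs1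
  have e5 : N * Real.log k ≤ 2 * s * Real.log k := mul_le_mul_of_nonneg_right hN hlogk
  have e6 : ((k : ℝ) - 1) * Real.log p ≤ (k - 1) * (Real.log (2 * K * k) * s +
      2 * s * Real.log k + N * Real.log d) :=
    mul_le_mul_of_nonneg_left (by linarith) hk1
  have e7 : ((k : ℝ) - 2) * (N * Real.log d) ≤
      (k - 2) * (n * δ + s * δ + 2 * s * Real.log 2) := mul_le_mul_of_nonneg_left hNlogd hk2.le
  have e8 : ((k : ℝ) - 2) * (n * δ) = n * H - n * h := by
    rw [mul_left_comm, hδk]; ring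
  -- the entropies combine as `n H - (k - 2) n δ = n h`; all other terms are `O(√n)`
  linear_combination e1 + e2 + 3 * e3 + e6 + e7 + e8 + hlogN + 2 * hlogd + hlogL + hlogO

end Asymptotics

theorem proposition3p1 (m k : ℕ) (hm : 2 ≤ m) (hk : 3 ≤ k) :
    ∃ (C : ℝ) (N : ℕ), ∀ n : ℕ, N ≤ n → k ∣ n →
      ∃ (L : ℕ) (x : Fin k → Fin L → (Fin n → ℤ)),
        Gam m k ^ ((n : ℝ) - C * Real.sqrt (n : ℝ)) ≤ (L : ℝ) ∧
        (∀ j : Fin k → Fin L,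
          (∑ i, x i (j i) = fun _ => (m : ℤ) - 1) ↔ ∀ i i' : Fin k, j i = j i') ∧
        (∀ i j l, 0 ≤ x i j l ∧ x i j l ≤ (m : ℤ) - 1) ∧
        (∀ i j, ((∑ l, x i j l : ℤ) : ℚ) = ((m : ℚ) - 1) * (n : ℚ) / (k : ℚ)) := by
  obtain ⟨M, rfl⟩ : ∃ M, m = M + 1 := ⟨m - 1, by omega⟩
  obtain ⟨h, C, hh, hGam, H⟩ := exists_large_collection (M := M) hk (by omega)
  obtain ⟨N, hN⟩ := exists_nat_ge ((C / h) ^ 2)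
  -- `N ≥ (C / h) ^ 2` makes the exponent nonnegative, so that `Gam` may be replaced by `exp h`
  refine ⟨C / h, N + 1, fun n hn hkn => ?_⟩
  obtain ⟨L, x, hL, h1, h2, h3⟩ := H n (by omega) hkn
  have hM : ((M + 1 : ℕ) : ℤ) - 1 = M := by push_cast; ring
  have hM' : ((M + 1 : ℕ) : ℚ) - 1 = M := by push_cast; ring
  rw [hM, hM']
  refine ⟨L, x, le_trans ?_ hL, h1, h2, fun i j => ?_⟩
  · have hs : C / h ≤ Real.sqrt n := by
      refine Real.le_sqrt_of_sq_le (hN.trans ?_)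
      exact_mod_cast (show N ≤ n by omega)
    have hexp : 0 ≤ (n : ℝ) - C / h * Real.sqrt n := by
      have := mul_le_mul_of_nonneg_right hs (Real.sqrt_nonneg n)
      rw [Real.mul_self_sqrt (Nat.cast_nonneg n)] at this
      linarith
    refine (Real.rpow_le_rpow (Gam_nonneg _ _) hGam hexp).trans (le_of_eq ?_)
    rw [← Real.exp_mul]
    congr 1
    field_simp
  · have hk0 : (k : ℚ) ≠ 0 := by
      have : k ≠ 0 := by omega
      exact_mod_cast this
    rw [eq_div_iff hk0, mul_comm]
    exact_mod_cast h3 i j
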